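/- Let $0<r_{\max}<\pi/4$ and let $S_+=\{\omega\in\mathbb C: 0<\arg\omega<2r_{\max}\}$. Let $\Gamma$ be a complex-valued function such that - $\Gamma$ is meromorphic in the open upper half-plane, with finitely many poles (of any order) in $S_+$; - there are constants $G,\Lambda\in\mathbb R$ and $\nu>0$ with $|\Gamma(\omega)|<G\,e^{-\nu|\mathrm{Re}\,\omega|}$ for all $\omega\in S_+$ with $|\omega|>\Lambda$; - $\Gamma$ is bounded on $S_+\cap\{|\omega|<\delta\}$ for some $\delta>0$, and at every real $x>0$ the function $\Gamma$, restricted to the closed upper half-plane, is continuous. For $\beta\in\mathbb R$ let $n_F(\omega)=1/(e^{\beta\omega}+1)$ and, for $t\ge 0$, $$\Delta^p_+(t)=\int_0^\infty \Gamma(\omega)\,(1-n_F(\omega))\,e^{i\omega t}\,\frac{d\omega}{2\pi},\qquad \Delta^h_+(t)=\int_0^\infty \Gamma(\omega)\,n_F(\omega)\,e^{i\omega t}\,\frac{d\omega}{2\pi}.$$ These integrals converge absolutely. Let $\Delta$ be one of $\Delta^p_+$, $\Delta^h_+$. For all $0<r<r_{\max}$ and $T_0>0$ there are $\varepsilon_0>0$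 and $c>0$, independent of $\beta$, such that for all $\beta\in\mathbb R$, $0<\varepsilon<\varepsilon_0$ and $T\ge T_0$ there are $N\in\mathbb N$ and $\Gamma_k,\omega_k\in\mathbb C$ with $\mathrm{Im}\,\omega_k\ge 0$ such that $$\Delta(t)=\sum_{k=1}^{N}\Gamma_k e^{i\omega_k t}+\delta(t)\quad(0\le t\le T),\qquad \int_0^T|\delta(t)|\,dt<\varepsilon,$$ $$N\le\frac{1}{2\pi r}\,\log\!\Big(\frac{\log(e+T)}{\varepsilon}\Big)\,\log\frac{T}{\varepsilon};$$ and if moreover $\log T\le\varepsilon^{-c}$ (in particular for every fixed $T$ and for $T$ growing polynomially in $1/\varepsilon$, once $\varepsilon$ is small), then such an approximation exists with $$N\le\frac{1}{2\pi r}\,\log\frac1\varepsilon\,\log\frac{T}{\varepsilon}.$$ The same holds for the negative-frequency parts $\Delta^p_-$, $\Delta^h_-$, defined by the same integrals over $(-\infty,0)$, when $\Gamma$ satisfies the same hypotheses with $S_-=\{\pi-2r_{\max}<\arg\omega<\pi\}$ in place of $S_+$ and $x<0$ in place of $x>0$. -/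

import Mathlib

open Complex

/-- The two half-lines of real frequencies, `ω > 0` and `ω < 0`. -/
inductive FreqSign
  | pos
  | neg

/-- The two components of the hybridization function. -/
inductive Species
  | particle
  | hole

/-- The half-line of real frequencies of the given sign. -/
def FreqSign.halfLine : FreqSign → Set ℝ
  | pos => Set.Ioi 0
  | neg => Set.Iio 0

/-- The open sector of opening `θ` in the upper half-plane adjacent to the half-line:
`0 < arg ω < θ` for positive frequencies, and its mirror image
`π - θ < arg ω < π` for negative frequencies. -/
def FreqSign.sector (θ : ℝ) : FreqSign → Set ℂ
  | pos => {ω | 0 < ω.arg ∧ ω.arg < θ}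
  | neg => {ω | Real.pi - θ < ω.arg ∧ ω.arg < Real.pi}

/-- The Fermi-Dirac distribution at inverse temperature `β`. -/
noncomputable def fermi (β : ℝ) (ω : ℂ) : ℂ :=
  1 / (exp (β * ω) + 1)

/-- The occupation factor: `1 - n_F` for particles and `n_F` for holes. -/
noncomputable def Species.occupation (β : ℝ) : Species → ℂ → ℂ
  | particle => fun ω => 1 - fermi β ω
  | hole => fun ω => fermi β ω

/-- The integrand `Γ(ω) (1 - n_F(ω)) e^{iωt} / 2π` (particle) or
`Γ(ω) n_F(ω) e^{iωt} / 2π` (hole). -/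
noncomputable def kernelIntegrand (Γ : ℂ → ℂ) (s : Species) (β t : ℝ) (ω : ℂ) : ℂ :=
  Γ ω * s.occupation β ω * exp (I * ω * t) / (2 * Real.pi)

/-- The part of the particle or hole kernel function that comes from the frequencies
of the given sign. -/
noncomputable def kernel (Γ : ℂ → ℂ) (b : FreqSign) (s : Species) (β t : ℝ) : ℂ :=
  ∫ ω in b.halfLine, kernelIntegrand Γ s β t (ω : ℂ)

/-- The hypotheses on the spectral density, on the side of the frequencies of sign `b`. -/
structure IsAdmissible (Γ : ℂ → ℂ) (b : FreqSign) (rmax : ℝ) : Prop where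
  /-- `Γ` is meromorphic in the open upper half-plane. -/
  meromorphic : MeromorphicOn Γ {ω | 0 < ω.im}
  /-- At least exponential decay at infinity in the sector of opening `2 rmax`. -/
  decay : ∃ G ν Λ : ℝ, 0 < ν ∧ ∀ ω ∈ b.sector (2 * rmax), Λ < ‖ω‖ →
    ‖Γ ω‖ < G * Real.exp (-ν * |ω.re|)
  /-- Finitely many poles in the sector. -/
  finite_poles : {ω | ω ∈ b.sector (2 * rmax) ∧ meromorphicOrderAt Γ ω < 0}.Finite
  /-- The values of `Γ` on the open real half-line are its boundary values from the upper
  half-plane. -/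
  boundary : ∀ x ∈ b.halfLine, ContinuousWithinAt Γ {ω | 0 ≤ ω.im} (x : ℂ)
  /-- `Γ` stays bounded as `ω → 0` in the sector. -/
  bounded_zero : ∃ C δ : ℝ, 0 < δ ∧ ∀ ω ∈ b.sector (2 * rmax), ‖ω‖ < δ → ‖Γ ω‖ ≤ C

/-- `Δ` is on `[0, T]` a sum of `N` non-growing complex exponentials, up to an error `δ` whose
`L¹` norm on `[0, T]` is below `ε`. -/
def ExpApprox (Δ : ℝ → ℂ) (T ε : ℝ) (N : ℕ) : Prop :=
  ∃ (g ω : Fin N → ℂ) (δ : ℝ → ℂ),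
    (∀ k, 0 ≤ (ω k).im) ∧
    (∀ t ∈ Set.Icc 0 T, Δ t = ∑ k, g k * exp (I * ω k * t) + δ t) ∧
    IntervalIntegrable δ MeasureTheory.volume 0 T ∧
    ∫ t in (0 : ℝ)..T, ‖δ t‖ < ε

/-! The idea is a contour rotation followed by the trapezoidal rule. In the variable `ω = e^u` the
sector becomes a horizontal strip. On a line centred in a strip of half-width `d < rmax`, the
trapezoidal rule with step `h` has error of order `e^{-2πd/h}` by Poisson summation
(`norm_trapezoid_sub_integral_le`), and each node contributes one decaying exponential `e^{iωt}`. On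
a ray inside the sector the integrand has `L¹` norm `O(1/(1+t))`, so on `[0, T]` the quadrature
error costs only a factor `log (1 + T)`; this is the source of `log (log (e + T) / ε)`. Cutting the
sum on the left costs a factor `T` and needs `N₁ h ≈ log (T / ε)`. On the right the decay is doubly
exponential, so `N₂ h` is only logarithmic in `log (T / ε)`. Choosing `r < d < rmax` lets the
leading constant absorb all lower-order terms.

The occupation factor is analytic and bounded on a sector away from the imaginary axis, uniformly in
`β` (`Species.exists_norm_occupation_le`); this is where `2 rmax < π / 2` enters.

Poles of `Γ` are cleared by a polynomial `Q = ∏ (ω - a)^m`, with `A = Q Γ`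
(`IsAdmissible.exists_regularization`). Hermite interpolation writes `e^{iωt} = H_t(ω) + Q(ω)
R_t(ω)`, where `H_t` combines the functions `t^l e^{iat}` (`Complex.exists_exp_interpolation`). The
contour is moved only for the pole-free part `A R_t`. The `H_t` parts, from the integral and from
the nodes alike, give a fixed number of terms `t^l e^{iat}`, each a limit of sums of `2^l`
exponentials. On rays avoiding the poles, `R_t = (e^{iωt} - H_t) / Q` yields the bounds with their
correct dependence on `t`.

Negative frequencies reduce to positive ones by `z ↦ -conj z`, together with `β ↦ -β`. -/

/-! ### Contour shifts and the trapezoidal rule in a strip -/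

open MeasureTheory in
theorem integrable_exp_neg_abs : Integrable (fun x : ℝ => Real.exp (-|x|)) := by
  rw [← integrableOn_univ, ← Set.Iic_union_Ioi (a := (0 : ℝ))]
  refine IntegrableOn.union ?_ ?_
  · refine (integrableOn_exp_Iic 0).congr_fun (fun x hx => ?_) measurableSet_Iic
    simp [abs_of_nonpos (Set.mem_Iic.1 hx)]
  · refine (integrableOn_exp_neg_Ioi 0).congr_fun (fun x hx => ?_) measurableSet_Ioi
    simp [abs_of_pos (Set.mem_Ioi.1 hx)]

open MeasureTheory Filter Topology in
/-- Contour shift between two horizontal lines for a function that decays in the strip. -/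
theorem integral_horizontal_line_eq {f : ℂ → ℂ} {a b C : ℝ} (hab : a ≤ b)
    (hc : ContinuousOn f {z | a ≤ z.im ∧ z.im ≤ b})
    (hd : DifferentiableOn ℂ f {z | a < z.im ∧ z.im < b})
    (hC : ∀ z : ℂ, a ≤ z.im → z.im ≤ b → ‖f z‖ ≤ C * Real.exp (-|z.re|)) :
    ∫ x : ℝ, f (x + a * I) = ∫ x : ℝ, f (x + b * I) := by
  have hInt : ∀ y, a ≤ y → y ≤ b → Integrable (fun x : ℝ => f (x + y * I)) := by
    intro y h1 h2
    refine Integrable.mono' (g := fun x : ℝ => C * Real.exp (-|x|)) ?_ ?_ ?_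
    · exact (integrable_exp_neg_abs).const_mul C
    · refine (Continuous.aestronglyMeasurable ?_)
      refine hc.comp_continuous (by fun_prop) (fun x => ?_)
      simp [h1, h2]
    · refine Eventually.of_forall fun x => ?_
      simpa using hC (x + y * I) (by simpa using h1) (by simpa using h2)
  have hrect : ∀ L : ℝ, (∫ x : ℝ in (-L)..L, f (x + a * I)) - (∫ x : ℝ in (-L)..L, f (x + b * I)) +
      I • (∫ y : ℝ in a..b, f (L + y * I)) - I • (∫ y : ℝ in a..b, f (-L + y * I)) = 0 := by
    intro L
    have := integral_boundary_rect_eq_zero_of_continuousOn_of_differentiableOn f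
      (⟨-L, a⟩ : ℂ) ⟨L, b⟩ (hc.mono ?_) (hd.mono ?_)
    · simpa using this
    · intro z hz
      rw [mem_reProdIm, Set.uIcc_of_le hab] at hz
      exact hz.2
    · intro z hz
      rw [mem_reProdIm] at hz
      simpa [hab] using hz.2
  have hvert : ∀ s : ℝ → ℝ, (∀ L, |s L| = |L|) →
      Tendsto (fun L : ℝ => I • (∫ y : ℝ in a..b, f (s L + y * I))) atTop (𝓝 0) := by
    intro s hs
    rw [tendsto_zero_iff_norm_tendsto_zero]
    have h0 : Tendsto (fun L : ℝ => C * Real.exp (-L) * |b - a|) atTop (𝓝 0) := by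
      simpa using ((Real.tendsto_exp_neg_atTop_nhds_zero.const_mul C).mul_const |b - a|)
    refine squeeze_zero' (Eventually.of_forall fun _ => norm_nonneg _) ?_ h0
    filter_upwards [eventually_ge_atTop 0] with L hL
    rw [norm_smul, norm_I, one_mul]
    refine intervalIntegral.norm_integral_le_of_norm_le_const fun y hy => ?_
    rw [Set.uIoc_of_le hab] at hy
    have := hC (s L + y * I) (by simpa using hy.1.le) (by simpa using hy.2)
    simpa [hs, abs_of_nonneg hL] using this
  have hlim := (((intervalIntegral_tendsto_integral (hInt a le_rfl hab) tendsto_neg_atTop_atBot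
    tendsto_id).sub (intervalIntegral_tendsto_integral (hInt b hab le_rfl)
    tendsto_neg_atTop_atBot tendsto_id)).add (hvert id (by simp))).sub (hvert (fun L => -L) (by simp))
  have hz : Tendsto (fun _ : ℝ => (0 : ℂ)) atTop (𝓝 0) := tendsto_const_nhds
  have := tendsto_nhds_unique (hlim.congr (fun L => by simpa using hrect L)) hz
  simpa [sub_eq_zero] using this

open MeasureTheory in
/-- Fourier integrals along a line decay exponentially at the rate given by the width of the
strip of analyticity. -/
theorem norm_fourier_horizontal_line_le {f : ℂ → ℂ} {a d B C : ℝ} (hd0 : 0 ≤ d)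
    (hc : ContinuousOn f {z | a - d ≤ z.im ∧ z.im ≤ a + d})
    (hd : DifferentiableOn ℂ f {z | a - d < z.im ∧ z.im < a + d})
    (hC : ∀ z : ℂ, a - d ≤ z.im → z.im ≤ a + d → ‖f z‖ ≤ C * Real.exp (-|z.re|))
    (hB₁ : ∫ x : ℝ, ‖f (x + (a - d : ℝ) * I)‖ ≤ B) (hB₂ : ∫ x : ℝ, ‖f (x + (a + d : ℝ) * I)‖ ≤ B)
    (ξ : ℝ) :
    ‖∫ x : ℝ, exp (-2 * Real.pi * I * ξ * x) * f (x + a * I)‖ ≤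
      B * Real.exp (-2 * Real.pi * d * |ξ|) := by
  set g : ℂ → ℂ := fun z => exp (-2 * Real.pi * I * ξ * (z - a * I)) * f z with hg
  have hnorm : ∀ z : ℂ, ‖g z‖ = Real.exp (2 * Real.pi * ξ * (z.im - a)) * ‖f z‖ := by
    intro z
    rw [hg, norm_mul, norm_exp]
    congr 2
    simp
  have hgC : ∀ z : ℂ, a - d ≤ z.im → z.im ≤ a + d →
      ‖g z‖ ≤ (Real.exp (2 * Real.pi * |ξ| * d) * C) * Real.exp (-|z.re|) := by
    intro z h1 h2
    rw [hnorm, mul_assoc (Real.exp _) C]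
    refine mul_le_mul (Real.exp_le_exp.2 ?_) (hC z h1 h2) (norm_nonneg _) (Real.exp_pos _).le
    rw [mul_assoc, mul_assoc (2 * Real.pi)]
    refine mul_le_mul_of_nonneg_left ?_ (by positivity)
    refine (le_abs_self _).trans ?_
    rw [abs_mul]
    exact mul_le_mul_of_nonneg_left (abs_le.2 ⟨by linarith, by linarith⟩) (abs_nonneg _)
  have hgc : ContinuousOn g {z | a - d ≤ z.im ∧ z.im ≤ a + d} :=
    ContinuousOn.mul (by fun_prop) hc
  have hgd : DifferentiableOn ℂ g {z | a - d < z.im ∧ z.im < a + d} :=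
    DifferentiableOn.mul (by fun_prop) hd
  have h0 : ∫ x : ℝ, exp (-2 * Real.pi * I * ξ * x) * f (x + a * I) = ∫ x : ℝ, g (x + a * I) := by
    simp [hg]
  have hline : ∀ y : ℝ, ‖∫ x : ℝ, g (x + y * I)‖ ≤
      Real.exp (2 * Real.pi * ξ * (y - a)) * ∫ x : ℝ, ‖f (x + y * I)‖ := by
    intro y
    refine (norm_integral_le_integral_norm _).trans_eq ?_
    rw [← integral_const_mul]
    congr 1
    ext x
    rw [hnorm]
    simp
  rw [h0]
  -- Move the line by `d` downwards or upwards according to the sign of `ξ`; either way the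
  -- exponential gains the factor `exp (-2πd|ξ|)`.
  rcases le_total 0 ξ with hξ | hξ
  · rw [← integral_horizontal_line_eq (a := a - d) (b := a) (by linarith)
      (hgc.mono fun z hz => ⟨hz.1, by linarith [hz.2]⟩)
      (hgd.mono fun z hz => ⟨hz.1, by linarith [hz.2]⟩)
      (fun z h1 h2 => hgC z h1 (by linarith))]
    refine (hline _).trans ?_
    rw [mul_comm]
    refine mul_le_mul hB₁ (Real.exp_le_exp.2 ?_) (Real.exp_pos _).le
      ((integral_nonneg fun _ => norm_nonneg _).trans hB₁)
    rw [abs_of_nonneg hξ]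
    apply le_of_eq; ring
  · rw [integral_horizontal_line_eq (a := a) (b := a + d) (by linarith)
      (hgc.mono fun z hz => ⟨by linarith [hz.1], hz.2⟩)
      (hgd.mono fun z hz => ⟨by linarith [hz.1], hz.2⟩)
      (fun z h1 h2 => hgC z (by linarith) h2)]
    refine (hline _).trans ?_
    rw [mul_comm]
    refine mul_le_mul hB₂ (Real.exp_le_exp.2 ?_) (Real.exp_pos _).le
      ((integral_nonneg fun _ => norm_nonneg _).trans hB₂)
    rw [abs_of_nonpos hξ]
    apply le_of_eq; ring

open MeasureTheory Filter Topology FourierTransform in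
/-- The trapezoidal rule is exponentially accurate for functions analytic in a strip. -/
theorem norm_trapezoid_sub_integral_le {f : ℂ → ℂ} {a d h B C : ℝ} (hd0 : 0 < d) (hh : 0 < h)
    (hc : ContinuousOn f {z | a - d ≤ z.im ∧ z.im ≤ a + d})
    (hd : DifferentiableOn ℂ f {z | a - d < z.im ∧ z.im < a + d})
    (hC : ∀ z : ℂ, a - d ≤ z.im → z.im ≤ a + d → ‖f z‖ ≤ C * Real.exp (-|z.re|))
    (hB₁ : ∫ x : ℝ, ‖f (x + (a - d : ℝ) * I)‖ ≤ B) (hB₂ : ∫ x : ℝ, ‖f (x + (a + d : ℝ) * I)‖ ≤ B)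
    (hq : Real.exp (-2 * Real.pi * d / h) ≤ 1 / 2) :
    ‖h * ∑' n : ℤ, f ((n * h : ℝ) + a * I) - ∫ x : ℝ, f (x + a * I)‖ ≤
      4 * B * Real.exp (-2 * Real.pi * d / h) := by
  set q := Real.exp (-2 * Real.pi * d / h) with hqdef
  have hq0 : 0 < q := Real.exp_pos _
  have hB0 : 0 ≤ B := (integral_nonneg fun _ => norm_nonneg _).trans hB₁
  -- Rescaled so that the nodes are the integers; the prefactor `h` makes the Fourier transform of
  -- `F` at `w` that of `f` on the line at `w / h`.
  set F : ℝ → ℂ := fun x => h * f ((x * h : ℝ) + a * I) with hF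
  have hFc : Continuous F := by
    refine continuous_const.mul (hc.comp_continuous (by fun_prop) fun x => ?_)
    simp [hd0.le]
  have hFT : ∀ w : ℝ, 𝓕 F w = ∫ x : ℝ, exp (-2 * Real.pi * I * (w / h : ℝ) * x) * f (x + a * I) := by
    intro w
    rw [Real.fourier_real_eq_integral_exp_smul]
    have := Measure.integral_comp_mul_right
      (fun x : ℝ => exp (-2 * Real.pi * I * (w / h : ℝ) * x) * f (x + a * I)) h
    rw [abs_of_pos (inv_pos.2 hh), eq_comm, inv_smul_eq_iff₀ hh.ne'] at this
    rw [this, ← integral_smul]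
    congr 1
    ext x
    have hh' : (h : ℂ) ≠ 0 := by exact_mod_cast hh.ne'
    have : (↑(-2 * Real.pi * x * w) * I : ℂ) =
        -2 * Real.pi * I * (w / h : ℝ) * (x * h : ℝ) := by
      push_cast
      field_simp
    rw [hF, smul_eq_mul, this, real_smul]
    ring
  have hbound : ∀ k : ℤ, ‖𝓕 F k‖ ≤ B * q ^ k.natAbs := by
    intro k
    rw [hFT]
    refine (norm_fourier_horizontal_line_le hd0.le hc hd hC hB₁ hB₂ _).trans_eq ?_
    rw [hqdef, ← Real.exp_nat_mul, abs_div, abs_of_pos hh, Nat.cast_natAbs, Int.cast_abs]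
    congr 2
    ring
  have hgeo : HasSum (fun n : ℕ => B * q ^ (n + 1)) (B * (q * (1 - q)⁻¹)) := by
    simp_rw [pow_succ']
    exact ((hasSum_geometric_of_lt_one hq0.le (by linarith)).mul_left q).mul_left B
  have hb1 : ∀ n : ℕ, ‖𝓕 F ((n + 1 : ℤ) : ℝ)‖ ≤ B * q ^ (n + 1) := fun n => by
    simpa [show ((n : ℤ) + 1).natAbs = n + 1 by omega] using hbound (n + 1)
  have hb2 : ∀ n : ℕ, ‖𝓕 F ((-(n + 1) : ℤ) : ℝ)‖ ≤ B * q ^ (n + 1) := fun n => by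
    have := hbound (-(n + 1))
    rwa [show (-((n : ℤ) + 1)).natAbs = n + 1 by omega] at this
  have hs1 : Summable fun n : ℕ => 𝓕 F ((n + 1 : ℤ) : ℝ) :=
    Summable.of_norm_bounded hgeo.summable hb1
  have hs2 : Summable fun n : ℕ => 𝓕 F ((-(n + 1) : ℤ) : ℝ) :=
    Summable.of_norm_bounded hgeo.summable hb2
  have hs : HasSum (fun n : ℤ => 𝓕 F (n : ℝ)) _ :=
    HasSum.of_add_one_of_neg_add_one hs1.hasSum hs2.hasSum
  have hdecay : F =O[cocompact ℝ] fun x : ℝ => |x| ^ (-2 : ℝ) := by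
    have h1 : F =O[cocompact ℝ] fun x : ℝ => Real.exp (-h * |x|) := by
      refine Asymptotics.IsBigO.of_bound (h * C) (Eventually.of_forall fun x => ?_)
      rw [hF, norm_mul, norm_real, Real.norm_of_nonneg hh.le, mul_assoc]
      refine mul_le_mul_of_nonneg_left ?_ hh.le
      rw [Real.norm_of_nonneg (Real.exp_pos _).le]
      refine (hC _ (by simp [hd0.le]) (by simp [hd0.le])).trans_eq ?_
      simp [abs_mul, abs_of_pos hh, mul_comm]
    refine h1.trans ?_
    exact ((isLittleO_exp_neg_mul_rpow_atTop hh (-2)).comp_tendsto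
      (tendsto_norm_cocompact_atTop (E := ℝ))).isBigO
  -- Poisson summation: the zeroth coefficient is the integral, so the quadrature error is the sum
  -- of the other ones, two geometric series of ratio `q ≤ 1 / 2`.
  have hP := Real.tsum_eq_tsum_fourier_of_rpow_decay_of_summable hFc one_lt_two hdecay hs.summable 0
  simp only [zero_add, QuotientAddGroup.mk_zero, fourier_eval_zero, mul_one] at hP
  rw [hs.tsum_eq, hF, tsum_mul_left] at hP
  have hF0 : 𝓕 F ((0 : ℤ) : ℝ) = ∫ x : ℝ, f (x + a * I) := by
    rw [hFT]; simp
  rw [hP, ← hF, hF0]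
  have e1 : ‖∑' n : ℕ, 𝓕 F ((n + 1 : ℤ) : ℝ)‖ ≤ 2 * B * q := by
    refine (tsum_of_norm_bounded hgeo hb1).trans ?_
    have : (1 - q)⁻¹ ≤ 2 := by
      rw [inv_le_comm₀ (by linarith) (by norm_num)]; linarith
    nlinarith [mul_nonneg hB0 hq0.le]
  have e2 : ‖∑' n : ℕ, 𝓕 F ((-(n + 1) : ℤ) : ℝ)‖ ≤ 2 * B * q := by
    refine (tsum_of_norm_bounded hgeo hb2).trans ?_
    have : (1 - q)⁻¹ ≤ 2 := by
      rw [inv_le_comm₀ (by linarith) (by norm_num)]; linarith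
    nlinarith [mul_nonneg hB0 hq0.le]
  rw [add_right_comm, add_sub_cancel_right]
  refine (norm_add_le _ _).trans ?_
  linarith

/-! ### Truncation of the trapezoidal sum -/

theorem Real.sq_mul_exp_neg_le {κ y : ℝ} (hκ : 0 < κ) (hy : 0 ≤ y) :
    y ^ 2 * Real.exp (-κ * y) ≤ 2 / κ ^ 2 := by
  have h := Real.pow_div_factorial_le_exp (κ * y) (by positivity) 2
  rw [neg_mul, Real.exp_neg, ← div_eq_mul_inv, div_le_div_iff₀ (Real.exp_pos _) (by positivity)]
  norm_num [Nat.factorial] at h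
  nlinarith

theorem Real.mul_inv_one_sub_exp_neg_le {h : ℝ} (h0 : 0 < h) (h1 : h ≤ 1) :
    h * (1 - Real.exp (-h))⁻¹ ≤ 2 := by
  have h2 : Real.exp (-h) ≤ (1 + h)⁻¹ := by
    rw [Real.exp_neg]
    exact inv_anti₀ (by linarith) (by linarith [Real.add_one_le_exp h])
  have h3 : (1 + h)⁻¹ = 1 - h / (1 + h) := by field_simp; ring
  have h4 : h / 2 ≤ h / (1 + h) := by gcongr; linarith
  rw [← div_eq_mul_inv, div_le_iff₀ (by linarith)]
  linarith

/-- Truncation error of a trapezoidal sum whose terms decay doubly exponentially to the right and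
exponentially to the left. -/
theorem norm_tsum_sub_sum_le {κ C h : ℝ} (hκ : 0 < κ) (hC : 0 ≤ C) (h0 : 0 < h) (h1 : h ≤ 1)
    {c : ℤ → ℂ}
    (hc : ∀ n : ℤ, ‖c n‖ ≤ C * (Real.exp (n * h) * Real.exp (-κ * Real.exp (n * h))))
    (N₁ N₂ : ℕ) :
    h * ‖∑' n, c n - (∑ i ∈ Finset.range N₂, c i + ∑ i ∈ Finset.range N₁, c (-(i + 1)))‖ ≤
      C * (2 + 16 / κ ^ 2) *
        (Real.exp (-(N₁ * h)) + Real.exp (-(κ / 2) * Real.exp (N₂ * h))) := by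
  set q := Real.exp (-h) with hq
  have hq0 : 0 < q := Real.exp_pos _
  have hq1 : q < 1 := by rw [hq, Real.exp_lt_one_iff]; linarith
  have hgeo := hasSum_geometric_of_lt_one hq0.le hq1
  have hup : ∀ N i : ℕ, ‖c ((i + N : ℕ) : ℤ)‖ ≤
      C * (8 / κ ^ 2) * Real.exp (-(κ / 2) * Real.exp (N * h)) * q ^ i := by
    intro N i
    refine (hc _).trans ?_
    rw [mul_assoc C, mul_assoc C]
    refine mul_le_mul_of_nonneg_left ?_ hC
    push_cast
    set y := Real.exp ((i + N) * h) with hy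
    have hy0 : 0 < y := Real.exp_pos _
    have hyN : Real.exp (N * h) ≤ y := Real.exp_le_exp.2 (by nlinarith [mul_nonneg (Nat.cast_nonneg (α := ℝ) i) h0.le])
    -- One half of the exponent pays for `y ^ 2`, leaving `y⁻¹ ≤ q ^ i` to sum geometrically; the
    -- other half gives the size of the tail.
    have e1 : Real.exp (-κ * y) = Real.exp (-(κ / 2) * y) * Real.exp (-(κ / 2) * y) := by
      rw [← Real.exp_add]; congr 1; ring
    have e2 : Real.exp (-(κ / 2) * y) ≤ Real.exp (-(κ / 2) * Real.exp (N * h)) := by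
      apply Real.exp_le_exp.2; nlinarith
    have e3 : y ^ 2 * Real.exp (-(κ / 2) * y) ≤ 8 / κ ^ 2 := by
      refine (Real.sq_mul_exp_neg_le (half_pos hκ) hy0.le).trans_eq ?_
      field_simp; norm_num
    have e4 : y⁻¹ ≤ q ^ i := by
      rw [hy, ← Real.exp_neg, hq, ← Real.exp_nat_mul]
      apply Real.exp_le_exp.2
      nlinarith [mul_nonneg (Nat.cast_nonneg (α := ℝ) N) h0.le]
    calc y * Real.exp (-κ * y)
        = (y ^ 2 * Real.exp (-(κ / 2) * y)) * Real.exp (-(κ / 2) * y) * y⁻¹ := by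
          rw [e1]; field_simp
      _ ≤ (8 / κ ^ 2) * Real.exp (-(κ / 2) * Real.exp (N * h)) * q ^ i := by
          gcongr
  have hlow : ∀ N i : ℕ, ‖c (-(((i + N : ℕ) : ℤ) + 1))‖ ≤ C * Real.exp (-(N * h)) * q ^ i := by
    intro N i
    refine (hc _).trans ?_
    rw [mul_assoc C]
    refine mul_le_mul_of_nonneg_left ?_ hC
    have e1 : Real.exp (((-(((i + N : ℕ) : ℤ) + 1) : ℤ) : ℝ) * h) ≤
        Real.exp (-(N * h)) * q ^ i := by
      rw [hq, ← Real.exp_nat_mul, ← Real.exp_add]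
      apply Real.exp_le_exp.2
      push_cast
      nlinarith
    refine (mul_le_of_le_one_right (Real.exp_pos _).le ?_).trans e1
    rw [Real.exp_le_one_iff]
    have := Real.exp_pos (((-(((i + N : ℕ) : ℤ) + 1) : ℤ) : ℝ) * h)
    nlinarith
  have hs1 : Summable fun n : ℕ => c n :=
    Summable.of_norm_bounded (hgeo.summable.mul_left _) (by simpa using hup 0)
  have hs2 : Summable fun n : ℕ => c (-(n + 1)) :=
    Summable.of_norm_bounded (hgeo.summable.mul_left _) (by simpa using hlow 0)
  rw [tsum_of_nat_of_neg_add_one hs1 hs2, ← hs1.sum_add_tsum_nat_add N₂,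
    ← hs2.sum_add_tsum_nat_add N₁]
  have t1 := tsum_of_norm_bounded (hgeo.mul_left _) (hup N₂)
  have t2 := tsum_of_norm_bounded (hgeo.mul_left _) (hlow N₁)
  rw [add_add_add_comm, add_sub_cancel_left]
  refine (mul_le_mul_of_nonneg_left ((norm_add_le _ _).trans (add_le_add t1 t2)) h0.le).trans ?_
  -- The weight `h` cancels the geometric constant `(1 - q)⁻¹ ~ 1 / h`, so the bound does not
  -- degrade for small steps.
  have h2 := Real.mul_inv_one_sub_exp_neg_le h0 h1
  rw [← hq] at h2
  set X := Real.exp (-(N₁ * h))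
  set Y := Real.exp (-(κ / 2) * Real.exp (N₂ * h))
  have hX : 0 ≤ X := (Real.exp_pos _).le
  have hY : 0 ≤ Y := (Real.exp_pos _).le
  have hk : 0 ≤ 8 / κ ^ 2 := by positivity
  calc h * (C * (8 / κ ^ 2) * Y * (1 - q)⁻¹ + C * X * (1 - q)⁻¹)
      = (C * (8 / κ ^ 2) * Y + C * X) * (h * (1 - q)⁻¹) := by ring
    _ ≤ (C * (8 / κ ^ 2) * Y + C * X) * 2 := by gcongr
    _ ≤ C * (2 + 16 / κ ^ 2) * (X + Y) := by
        have : (16 : ℝ) / κ ^ 2 = 2 * (8 / κ ^ 2) := by ring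
        rw [this]
        have := mul_nonneg hC hY
        have := mul_nonneg (mul_nonneg hC hX) hk
        nlinarith

/-! ### Growth bounds for polynomials, exponentials and Taylor remainders -/

theorem Polynomial.norm_eval_le_exp (p : Polynomial ℂ) {κ : ℝ} (hκ : 0 < κ) :
    ∃ C, 0 ≤ C ∧ ∀ z : ℂ, ‖p.eval z‖ ≤ C * Real.exp (κ * ‖z‖) := by
  induction p using Polynomial.induction_on' with
  | add p q hp hq =>
    obtain ⟨C, hC, h⟩ := hp
    obtain ⟨D, hD, k⟩ := hq
    refine ⟨C + D, by positivity, fun z => ?_⟩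
    rw [Polynomial.eval_add, add_mul]
    exact (norm_add_le _ _).trans (add_le_add (h z) (k z))
  | monomial n a =>
    refine ⟨‖a‖ * (n.factorial / κ ^ n), by positivity, fun z => ?_⟩
    rw [Polynomial.eval_monomial, norm_mul, norm_pow, mul_assoc]
    refine mul_le_mul_of_nonneg_left ?_ (norm_nonneg _)
    have := Real.pow_div_factorial_le_exp (κ * ‖z‖) (by positivity) n
    rw [mul_pow, div_le_iff₀ (by positivity)] at this
    rw [div_mul_eq_mul_div, le_div_iff₀ (by positivity)]
    linarith

theorem Real.pow_mul_exp_neg_le (l : ℕ) {b : ℝ} (hb : 0 < b) :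
    ∃ C, 0 ≤ C ∧ ∀ t : ℝ, 0 ≤ t → t ^ l * Real.exp (-b * t) ≤ C / (1 + t) := by
  obtain ⟨C, hC, h⟩ :=
    Polynomial.norm_eval_le_exp (Polynomial.X ^ l * (1 + Polynomial.X)) hb
  refine ⟨C, hC, fun t ht => ?_⟩
  have := h t
  have e : ‖(1 : ℂ) + t‖ = 1 + t := by
    rw [← ofReal_one, ← ofReal_add, norm_real, Real.norm_of_nonneg (by linarith)]
  simp only [Polynomial.eval_mul, Polynomial.eval_pow, Polynomial.eval_X, Polynomial.eval_add,
    Polynomial.eval_one, norm_mul, norm_pow, norm_real, Real.norm_of_nonneg ht, e] at this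
  rw [neg_mul, Real.exp_neg, le_div_iff₀ (by linarith), mul_right_comm, ← div_eq_mul_inv,
    div_le_iff₀ (Real.exp_pos _)]
  exact this

/-- Taylor expansion of the exponential at `0` with an entire remainder. -/
theorem Complex.exists_exp_eq_sum_add_pow_mul (m : ℕ) :
    ∃ (c : ℕ → ℂ) (φ : ℂ → ℂ) (C : ℝ), Differentiable ℂ φ ∧ 0 ≤ C ∧
      (∀ z, ‖φ z‖ ≤ C * (1 + Real.exp z.re)) ∧
      ∀ z, exp z = ∑ l ∈ Finset.range m, c l * z ^ l + z ^ m * φ z := by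
  induction m with
  | zero =>
    refine ⟨0, exp, 1, differentiable_exp, zero_le_one, fun z => ?_, fun z => by simp⟩
    rw [norm_exp]; linarith
  | succ m ih =>
    obtain ⟨c, φ, C, hφ, hC, hb, he⟩ := ih
    have hd : Differentiable ℂ (dslope φ 0) := by
      rw [← differentiableOn_univ, Complex.differentiableOn_dslope Filter.univ_mem]
      exact hφ.differentiableOn
    obtain ⟨D, hD⟩ := (isCompact_closedBall (0 : ℂ) 1).exists_bound_of_continuousOn
      hd.continuous.continuousOn
    -- The next remainder is the difference quotient of `φ` at `0`. On the unit ball compactness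
    -- gives `|D|`; outside it, `‖φ z‖ + ‖φ 0‖ ≤ C (1 + exp z.re) + 2 C`.
    refine ⟨fun l => if l = m then φ 0 else c l, dslope φ 0, |D| + 3 * C, hd, by positivity,
      fun z => ?_, fun z => ?_⟩
    · have hez := Real.exp_pos z.re
      by_cases hz : ‖z‖ ≤ 1
      · have := hD z (by simpa using hz)
        have h2 := le_abs_self D
        nlinarith [abs_nonneg D]
      · push Not at hz
        have hz0 : z ≠ 0 := by rintro rfl; simp at hz; linarith
        rw [dslope_of_ne _ hz0, slope_def_field, norm_div, sub_zero]
        refine (div_le_self (norm_nonneg _) hz.le).trans ((norm_sub_le _ _).trans ?_)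
        have h1 := hb z
        have h2 := hb 0
        simp at h2
        nlinarith [abs_nonneg D]
    · have h1 : z * dslope φ 0 z = φ z - φ 0 := by
        simpa using sub_smul_dslope φ 0 z
      beta_reduce
      rw [Finset.sum_range_succ, if_pos rfl, he z, pow_succ, mul_assoc, h1]
      have : ∑ l ∈ Finset.range m, (if l = m then φ 0 else c l) * z ^ l =
          ∑ l ∈ Finset.range m, c l * z ^ l :=
        Finset.sum_congr rfl fun l hl => by rw [if_neg (Finset.mem_range.1 hl).ne]
      rw [this]
      ring

theorem Real.exp_mul_exp_neg_exp_le {κ : ℝ} (hκ : 0 < κ) (x : ℝ) :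
    Real.exp x * Real.exp (-κ * Real.exp x) ≤ (1 + 2 / κ ^ 2) * Real.exp (-|x|) := by
  rcases le_total x 0 with hx | hx
  · rw [abs_of_nonpos hx, neg_neg]
    have h1 : Real.exp (-κ * Real.exp x) ≤ 1 := by
      rw [Real.exp_le_one_iff]; nlinarith [Real.exp_pos x]
    have h2 : (1 : ℝ) ≤ 1 + 2 / κ ^ 2 := by
      have : 0 < 2 / κ ^ 2 := by positivity
      linarith
    nlinarith [Real.exp_pos x, mul_le_mul_of_nonneg_left h1 (Real.exp_pos x).le]
  · rw [abs_of_nonneg hx, Real.exp_neg, ← div_eq_mul_inv, le_div_iff₀ (Real.exp_pos x)]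
    have := Real.sq_mul_exp_neg_le hκ (Real.exp_pos x).le
    nlinarith

open MeasureTheory Filter Topology in
theorem integrable_exp_mul_exp_neg_exp {κ : ℝ} (hκ : 0 < κ) :
    Integrable (fun x : ℝ => Real.exp x * Real.exp (-κ * Real.exp x)) ∧
      ∫ x : ℝ, Real.exp x * Real.exp (-κ * Real.exp x) = 1 / κ := by
  have hder : ∀ x : ℝ, HasDerivAt (fun x => -(1 / κ) * Real.exp (-κ * Real.exp x))
      (Real.exp x * Real.exp (-κ * Real.exp x)) x := by
    intro x
    refine ((((Real.hasDerivAt_exp x).const_mul (-κ)).exp).const_mul (-(1 / κ))).congr_deriv ?_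
    field_simp
  have hbot : Tendsto (fun x => -(1 / κ) * Real.exp (-κ * Real.exp x)) atBot (𝓝 (-(1 / κ))) := by
    have : Continuous fun y : ℝ => -(1 / κ) * Real.exp (-κ * y) := by fun_prop
    simpa [Function.comp_def] using (this.tendsto 0).comp Real.tendsto_exp_atBot
  have htop : Tendsto (fun x => -(1 / κ) * Real.exp (-κ * Real.exp x)) atTop (𝓝 0) := by
    have h1 : Tendsto (fun x : ℝ => -κ * Real.exp x) atTop atBot :=
      Real.tendsto_exp_atTop.const_mul_atTop_of_neg (by linarith)
    simpa [Function.comp_def] using (Real.tendsto_exp_atBot.comp h1).const_mul (-(1 / κ))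
  have hInt : Integrable (fun x : ℝ => Real.exp x * Real.exp (-κ * Real.exp x)) := by
    refine (integrable_exp_neg_abs.const_mul (1 + 2 / κ ^ 2)).mono'
      (by fun_prop) (Eventually.of_forall fun x => ?_)
    rw [Real.norm_of_nonneg (by positivity)]
    exact Real.exp_mul_exp_neg_exp_le hκ x
  refine ⟨hInt, ?_⟩
  rw [integral_of_hasDerivAt_of_tendsto hder hInt hbot htop]
  simp

/-! ### The occupation factor on a sector -/

/-- If `|Im z| ≤ π / 2`, the real part of `e^z + 1` is at least `1`. Otherwise the cone condition
forces `|Re z| ≥ π / (2τ)`, which keeps `|e^z|` away from `1`. -/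
theorem Complex.exists_le_norm_exp_add_one {τ : ℝ} (hτ : 0 < τ) :
    ∃ B, 0 < B ∧ ∀ z : ℂ, |z.im| ≤ τ * |z.re| → B ≤ ‖exp z + 1‖ := by
  set x₀ := Real.pi / (2 * τ) with hx₀
  have hx0 : 0 < x₀ := by positivity
  have hlt : Real.exp (-x₀) < 1 := by rw [Real.exp_lt_one_iff]; linarith
  refine ⟨1 - Real.exp (-x₀), by linarith, fun z hz => ?_⟩
  by_cases hy : |z.im| ≤ Real.pi / 2
  · have hcos : 0 ≤ Real.cos z.im := Real.cos_nonneg_of_mem_Icc (abs_le.1 hy)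
    have h1 : 1 ≤ (exp z + 1).re := by
      rw [add_re, exp_re, one_re]
      nlinarith [mul_nonneg (Real.exp_pos z.re).le hcos]
    linarith [(le_abs_self _).trans (abs_re_le_norm (exp z + 1)), Real.exp_pos (-x₀)]
  · push Not at hy
    have hx : x₀ ≤ |z.re| := by
      rw [hx₀, div_le_iff₀ (by positivity)]
      nlinarith
    have h1 : |Real.exp z.re - 1| ≤ ‖exp z + 1‖ := by
      have := abs_norm_sub_norm_le (exp z) (-1)
      rwa [norm_neg, norm_one, norm_exp, sub_neg_eq_add] at this
    refine le_trans ?_ h1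
    rcases abs_cases z.re with ⟨h2, -⟩ | ⟨h2, -⟩
    · refine le_trans ?_ (le_abs_self _)
      have := Real.add_one_le_exp (-x₀)
      have := Real.add_one_le_exp z.re
      linarith
    · refine le_trans ?_ (neg_le_abs _)
      have : Real.exp z.re ≤ Real.exp (-x₀) := Real.exp_le_exp.2 (by linarith)
      linarith

/-- The occupation factors are bounded on a sector around the real line, uniformly in `β`. -/
theorem Species.exists_norm_occupation_le {τ : ℝ} (hτ : 0 < τ) :
    ∃ B, 0 < B ∧ ∀ (s : Species) (β : ℝ) (ω : ℂ), |ω.im| ≤ τ * |ω.re| →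
      exp (β * ω) + 1 ≠ 0 ∧ ‖s.occupation β ω‖ ≤ B := by
  obtain ⟨b, hb, h⟩ := Complex.exists_le_norm_exp_add_one hτ
  refine ⟨1 + 1 / b, by positivity, fun s β ω hω => ?_⟩
  -- The double cone is invariant under real scaling of either sign, hence the uniformity in `β`.
  have h1 : b ≤ ‖exp (β * ω) + 1‖ := by
    refine h _ ?_
    rw [re_ofReal_mul, im_ofReal_mul, abs_mul, abs_mul]
    nlinarith [abs_nonneg β, mul_le_mul_of_nonneg_left hω (abs_nonneg β)]
  have h2 : ‖fermi β ω‖ ≤ 1 / b := by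
    rw [fermi, norm_div, norm_one]
    exact one_div_le_one_div_of_le hb h1
  refine ⟨norm_pos_iff.1 (hb.trans_le h1), ?_⟩
  cases s with
  | particle => exact (norm_sub_le _ _).trans (by rw [norm_one]; linarith)
  | hole => exact h2.trans (by linarith)

theorem Species.differentiableAt_occupation (s : Species) {β : ℝ} {ω : ℂ}
    (h : exp (β * ω) + 1 ≠ 0) : DifferentiableAt ℂ (s.occupation β) ω := by
  have : DifferentiableAt ℂ (fermi β) ω := by
    unfold fermi
    exact (differentiableAt_const _).div (by fun_prop) h
  cases s with
  | particle => exact (differentiableAt_const _).sub this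
  | hole => exact this

/-! ### Clearing the poles of the spectral density -/

open Filter Topology in
/-- Multiplication by a polynomial removes finitely many poles. -/
theorem MeromorphicOn.exists_pow_meromorphicOrderAt_nonneg {f : ℂ → ℂ} {U : Set ℂ}
    (hf : MeromorphicOn f U) (Z : Finset ℂ)
    (hZ : ∀ z ∈ U, meromorphicOrderAt f z < 0 → z ∈ Z) :
    ∃ m : ℕ, ∀ z ∈ U, 0 ≤ meromorphicOrderAt (fun w => (∏ a ∈ Z, (w - a) ^ m) * f w) z := by
  -- `n z` is an exponent for which `(w - z) ^ n z • f w` is analytic at `z`; the maximum over `Z`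
  -- serves all poles at once.
  choose! n hn using hf
  refine ⟨Z.sup n, fun z hz => ?_⟩
  have hQ : ∀ (Y : Finset ℂ) (m : ℕ), AnalyticAt ℂ (fun w => ∏ a ∈ Y, (w - a) ^ m) z :=
    fun Y m => Finset.analyticAt_fun_prod _ fun a _ => by fun_prop
  by_cases hzZ : z ∈ Z
  · have hle : n z ≤ Z.sup n := Finset.le_sup hzZ
    have he : (fun w => (∏ a ∈ Z, (w - a) ^ Z.sup n) * f w) =
        fun w => (∏ a ∈ Z.erase z, (w - a) ^ Z.sup n) * (w - z) ^ (Z.sup n - n z) *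
          ((w - z) ^ n z • f w) := by
      ext w
      rw [← Finset.mul_prod_erase Z _ hzZ, smul_eq_mul]
      nth_rewrite 1 [← Nat.sub_add_cancel hle]
      rw [pow_add]
      ring
    rw [he]
    exact (((hQ _ _).mul (by fun_prop)).mul (hn z hz)).meromorphicOrderAt_nonneg
  · have h1 : 0 ≤ meromorphicOrderAt f z := not_lt.1 fun h => hzZ (hZ z hz h)
    have h2 := meromorphicOrderAt_mul (hQ Z (Z.sup n)).meromorphicAt (g := f) (x := z) ⟨n z, hn z hz⟩
    exact (add_nonneg (hQ Z (Z.sup n)).meromorphicOrderAt_nonneg h1).trans_eq h2.symm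

theorem Complex.arg_exp_of_mem {u : ℂ} (h0 : 0 ≤ u.im) (h1 : u.im ≤ Real.pi) :
    (exp u).arg = u.im := by
  rw [← log_im, log_exp (by linarith [Real.pi_pos]) h1]

theorem Complex.im_pos_of_arg_pos {z : ℂ} (h0 : 0 < z.arg) (h1 : z.arg < Real.pi) : 0 < z.im := by
  rcases (arg_nonneg_iff.1 h0.le).lt_or_eq with h | h
  · exact h
  · rcases le_or_gt 0 z.re with hr | hr
    · exact absurd (arg_eq_zero_iff.2 ⟨hr, h.symm⟩) h0.ne'
    · exact absurd (arg_eq_pi_iff.2 ⟨hr, h.symm⟩) h1.ne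

open Filter Topology in
/-- Clearing the poles of an admissible spectral density: `A` is `Γ` times a polynomial, analytic
in the sector, continuous up to the real half-line, and still exponentially decaying. -/
theorem IsAdmissible.exists_regularization {Γ : ℂ → ℂ} {rmax : ℝ} (h0 : 0 < rmax)
    (h1 : rmax < Real.pi / 4) (hΓ : IsAdmissible Γ .pos rmax) :
    ∃ (Z : Finset ℂ) (m : ℕ) (A : ℂ → ℂ), Z.Nonempty ∧
      (∀ a ∈ Z, 0 < a.arg ∧ a.arg < 2 * rmax) ∧
      DifferentiableOn ℂ (fun u => A (exp u)) {u | 0 < u.im ∧ u.im < 2 * rmax} ∧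
      ContinuousOn (fun u => A (exp u)) {u | 0 ≤ u.im ∧ u.im < 2 * rmax} ∧
      (∀ x : ℝ, A x = (∏ a ∈ Z, (x - a) ^ m) * Γ x) ∧
      ∀ θ, 0 < θ → θ < 2 * rmax → ∃ C κ, 0 ≤ C ∧ 0 < κ ∧ ∀ u : ℂ, 0 ≤ u.im → u.im ≤ θ →
        ‖A (exp u)‖ ≤ C * Real.exp (-κ * Real.exp u.re) := by
  classical
  have hπ := Real.pi_pos
  set S : Set ℂ := {ω | 0 < ω.arg ∧ ω.arg < 2 * rmax} with hS
  set U : Set ℂ := {ω | 0 < ω.im} with hU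
  have hSU : S ⊆ U := fun z hz => im_pos_of_arg_pos hz.1 (by linarith [hz.2])
  have hexpS : ∀ u : ℂ, 0 < u.im → u.im < 2 * rmax → exp u ∈ S := fun u h2 h3 => by
    rw [hS, Set.mem_ofPred_eq, arg_exp_of_mem h2.le (by linarith)]
    exact ⟨h2, h3⟩
  have hfin : {ω | ω ∈ S ∧ meromorphicOrderAt Γ ω < 0}.Finite := hΓ.finite_poles
  -- The extra point only makes `Z` nonempty, as the later Bézout identity requires.
  set Z : Finset ℂ := insert (exp (rmax * I)) hfin.toFinset with hZdef
  have hZS : ∀ a ∈ Z, a ∈ S := by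
    intro a ha
    rcases Finset.mem_insert.1 ha with rfl | ha
    · exact hexpS _ (by simpa using h0) (by simp; linarith)
    · exact ((hfin.mem_toFinset).1 ha).1
  have hmS : MeromorphicOn Γ S := fun z hz => hΓ.meromorphic z (hSU hz)
  obtain ⟨m, hm⟩ := hmS.exists_pow_meromorphicOrderAt_nonneg Z fun z hz hlt =>
    Finset.mem_insert_of_mem ((hfin.mem_toFinset).2 ⟨hz, hlt⟩)
  set Q : ℂ → ℂ := fun w => ∏ a ∈ Z, (w - a) ^ m with hQ
  have hQc : Continuous Q := by fun_prop
  set P : ℂ → ℂ := fun w => Q w * Γ w with hP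
  have hPm : MeromorphicOn P U := fun z hz =>
    MeromorphicAt.mul (AnalyticAt.meromorphicAt
      (Finset.analyticAt_fun_prod _ fun a _ => by fun_prop)) (hΓ.meromorphic z hz)
  -- The normal form repairs the values of `P` at removable singularities inside `U` and changes
  -- nothing on the real axis.
  set A := toMeromorphicNFOn P U with hA
  have hAan : ∀ z ∈ S, AnalyticAt ℂ A z := fun z hz => by
    rw [← (meromorphicNFOn_toMeromorphicNFOn P U (hSU hz)).meromorphicOrderAt_nonneg_iff_analyticAt,
      meromorphicOrderAt_toMeromorphicNFOn hPm (hSU hz)]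
    exact hm z hz
  have hAP : ∀ z ∈ S, A =ᶠ[𝓝[≠] z] P := fun z hz =>
    hPm.toMeromorphicNFOn_eq_self_on_nhdsNE (hSU hz)
  have hPlim : ∀ z ∈ S, Tendsto P (𝓝[≠] z) (𝓝 (A z)) := fun z hz =>
    ((hAan z hz).continuousAt.tendsto.mono_left nhdsWithin_le_nhds).congr' (hAP z hz)
  have hAreal : ∀ z, z.im = 0 → A z = P z := fun z hz =>
    toMeromorphicNFOn_eq_self_on_compl hPm (show z ∈ Uᶜ by simp [hU, hz])
  have hUo : IsOpen U := isOpen_lt continuous_const continuous_im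
  have hSnhds : ∀ z ∈ S, S ∈ 𝓝 z := by
    intro z hz
    have hslit : z ∈ slitPlane := Or.inr (hSU hz).ne'
    exact (continuousAt_arg hslit).preimage_mem_nhds (Ioo_mem_nhds hz.1 hz.2)
  have hbd : ∀ x : ℝ, 0 < x → ContinuousWithinAt A (S ∪ {z | z.im = 0}) x := by
    intro x hx
    have hPx : ContinuousWithinAt P {ω | 0 ≤ ω.im} (x : ℂ) :=
      hQc.continuousWithinAt.mul (hΓ.boundary x hx)
    rw [Metric.continuousWithinAt_iff] at hPx ⊢
    intro ε hε
    obtain ⟨δ, hδ, h⟩ := hPx (ε / 2) (half_pos hε)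
    refine ⟨δ, hδ, fun {z} hz hzx => ?_⟩
    rw [hAreal x (ofReal_im x)]
    rcases hz with hz | hz
    -- `A z` may differ from `P z`, but it is a limit of values of `P` near `z`, all within `ε / 2`
    -- of `P x`.
    · have : A z ∈ Metric.closedBall (P x) (ε / 2) := by
        refine Metric.isClosed_closedBall.mem_of_tendsto (hPlim z hz) ?_
        refine Filter.Eventually.filter_mono nhdsWithin_le_nhds ?_
        filter_upwards [hUo.mem_nhds (hSU hz), Metric.isOpen_ball.mem_nhds (Metric.mem_ball.2 hzx)]
          with w hw1 hw2
        have hw3 : (0 : ℝ) ≤ w.im := (show (0 : ℝ) < w.im from hw1).le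
        exact (h hw3 hw2).le
      have := Metric.mem_closedBall.1 this
      linarith
    · rw [hAreal z hz]
      have := h (show z ∈ {ω : ℂ | 0 ≤ ω.im} from (le_of_eq (Eq.symm hz))) hzx
      linarith
  have hcont : ContinuousOn (fun u => A (exp u)) {u | 0 ≤ u.im ∧ u.im < 2 * rmax} := by
    intro u hu
    rcases hu.1.lt_or_eq with h2 | h2
    · exact ((hAan _ (hexpS u h2 hu.2)).continuousAt.comp
        continuous_exp.continuousAt).continuousWithinAt
    · have hux : exp u = (Real.exp u.re : ℝ) := by
        rw [ofReal_exp]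
        congr 1
        exact Complex.ext rfl h2.symm
      have := hbd _ (Real.exp_pos u.re)
      rw [← hux] at this
      refine this.comp continuous_exp.continuousWithinAt fun v hv => ?_
      rcases hv.1.lt_or_eq with h3 | h3
      · exact Or.inl (hexpS v h3 hv.2)
      · right
        rw [Set.mem_ofPred_eq, exp_im, ← h3]
        simp
  -- bounds for `Γ` on the sector pass to `A` up to the real half-line
  have hpass : ∀ (V : Set ℂ) (g : ℂ → ℝ), IsOpen V → Continuous g →
      (∀ ω ∈ S, ω ∈ V → ‖Γ ω‖ ≤ g ω) → ∀ u : ℂ, 0 ≤ u.im → u.im < 2 * rmax → exp u ∈ V →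
      ‖A (exp u)‖ ≤ ‖Q (exp u)‖ * g (exp u) := by
    intro V g hV hg hVg
    have hin : ∀ z ∈ S, z ∈ V → ‖A z‖ ≤ ‖Q z‖ * g z := by
      intro z hz hzV
      have hR : Tendsto (fun w => ‖Q w‖ * g w) (𝓝[≠] z) (𝓝 (‖Q z‖ * g z)) :=
        ((hQc.norm.mul hg).tendsto z).mono_left nhdsWithin_le_nhds
      refine le_of_tendsto_of_tendsto (hPlim z hz).norm hR ?_
      refine Filter.Eventually.filter_mono nhdsWithin_le_nhds ?_
      filter_upwards [hSnhds z hz, hV.mem_nhds hzV] with w hw1 hw2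
      rw [hP, norm_mul]
      exact mul_le_mul_of_nonneg_left (hVg w hw1 hw2) (norm_nonneg _)
    intro u hu1 hu2 huV
    rcases hu1.lt_or_eq with h2 | h2
    · exact hin _ (hexpS u h2 hu2) huV
    have hpath : Tendsto (fun y : ℝ => u + y * I) (𝓝[>] 0) (𝓝 u) := by
      have : Continuous fun y : ℝ => u + y * I := by fun_prop
      simpa using (this.tendsto 0).mono_left nhdsWithin_le_nhds
    have hmem : ∀ᶠ y : ℝ in 𝓝[>] 0, 0 < (u + y * I).im ∧ (u + y * I).im < 2 * rmax := by
      filter_upwards [Ioo_mem_nhdsGT (show (0 : ℝ) < 2 * rmax by linarith)] with y hy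
      simpa [← h2] using hy
    have hl : Tendsto (fun y : ℝ => A (exp (u + y * I))) (𝓝[>] 0) (𝓝 (A (exp u))) :=
      (hcont u ⟨hu1, hu2⟩).tendsto.comp (tendsto_nhdsWithin_iff.2
        ⟨hpath, hmem.mono fun y hy => ⟨hy.1.le, hy.2⟩⟩)
    have hr : Tendsto (fun y : ℝ => ‖Q (exp (u + y * I))‖ * g (exp (u + y * I))) (𝓝[>] 0)
        (𝓝 (‖Q (exp u)‖ * g (exp u))) :=
      (((hQc.norm.mul hg).comp continuous_exp).tendsto u).comp hpath
    refine le_of_tendsto_of_tendsto hl.norm hr ?_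
    filter_upwards [hmem, hpath ((hV.preimage continuous_exp).mem_nhds huV)] with y hy hyV
    exact hin _ (hexpS _ hy.1 hy.2) hyV
  refine ⟨Z, m, A, ⟨_, Finset.mem_insert_self _ _⟩, hZS, ?_, hcont,
    fun x => hAreal x (ofReal_im x), ?_⟩
  · intro u hu
    exact ((hAan _ (hexpS u hu.1 hu.2)).differentiableAt.comp u
      differentiable_exp.differentiableAt).differentiableWithinAt
  intro θ hθ0 hθ1
  obtain ⟨G, ν, Λ, hν, hdec⟩ := hΓ.decay
  obtain ⟨C₀, δ, hδ, hzero⟩ := hΓ.bounded_zero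
  have hk : 0 < Real.cos θ := Real.cos_pos_of_mem_Ioo ⟨by linarith, by linarith⟩
  -- In the sector `|Re ω| ≥ cos θ · |ω|`, so `Γ` decays at rate `2κ` in `|ω|`; half of this is
  -- spent on the growth of `Q`.
  set κ := ν * Real.cos θ / 2 with hκ
  have hκ0 : 0 < κ := by positivity
  obtain ⟨D, hD, hQD⟩ := Polynomial.norm_eval_le_exp
    (∏ a ∈ Z, (Polynomial.X - Polynomial.C a) ^ m) hκ0
  replace hQD : ∀ z, ‖Q z‖ ≤ D * Real.exp (κ * ‖z‖) := fun z => by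
    simpa [Polynomial.eval_prod, hQ] using hQD z
  -- Three ranges of `u.re`: beyond `x₂` the decay hypothesis applies, below `x₁` the boundedness
  -- near `0`, and in between compactness.
  set x₁ := Real.log δ - 1
  set x₂ := Real.log (max Λ 1) + 1
  have hcompact : IsCompact (Set.Icc x₁ x₂ ×ℂ Set.Icc 0 θ) := isCompact_Icc.reProdIm isCompact_Icc
  obtain ⟨M, hM⟩ := hcompact.exists_bound_of_continuousOn
    (hcont.mono fun u hu => ⟨hu.2.1, hu.2.2.trans_lt hθ1⟩)
  refine ⟨D * |G| + D * |C₀| * Real.exp (2 * κ * δ) + |M| * Real.exp (κ * Real.exp x₂), κ,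
    by positivity, hκ0, fun u hu1 hu2 => ?_⟩
  have hn : ‖exp u‖ = Real.exp u.re := norm_exp u
  have p1 : 0 ≤ D * |G| := by positivity
  have p2 : 0 ≤ D * |C₀| * Real.exp (2 * κ * δ) := by positivity
  have p3 : 0 ≤ |M| * Real.exp (κ * Real.exp x₂) := by positivity
  have pe : 0 < Real.exp (-κ * Real.exp u.re) := Real.exp_pos _
  by_cases hx2 : x₂ < u.re
  · have hΛ : Λ < ‖exp u‖ := by
      have hm0 : 0 < max Λ 1 := by positivity
      have h3 : max Λ 1 < Real.exp u.re := by
        rw [← Real.log_lt_iff_lt_exp hm0]; simp only [x₂] at hx2; linarith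
      rw [hn]
      exact (le_max_left _ _).trans_lt h3
    have h4 := hpass {ω | Λ < ‖ω‖} (fun ω => |G| * Real.exp (-ν * |ω.re|))
      (isOpen_lt continuous_const continuous_norm) (by fun_prop)
      (fun ω hω hωV => (hdec ω hω hωV).le.trans
        (mul_le_mul_of_nonneg_right (le_abs_self G) (Real.exp_pos _).le)) u hu1 (hu2.trans_lt hθ1) hΛ
    have hre : Real.cos θ * Real.exp u.re ≤ |(exp u).re| := by
      rw [exp_re, mul_comm]
      refine le_trans ?_ (le_abs_self _)
      exact mul_le_mul_of_nonneg_left (Real.cos_le_cos_of_nonneg_of_le_pi hu1 (by linarith) hu2)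
        (Real.exp_pos _).le
    have h5 : ‖A (exp u)‖ ≤ (D * |G|) * Real.exp (-κ * Real.exp u.re) := by
      refine h4.trans ?_
      calc ‖Q (exp u)‖ * (|G| * Real.exp (-ν * |(exp u).re|))
          ≤ (D * Real.exp (κ * ‖exp u‖)) * (|G| * Real.exp (-ν * (Real.cos θ * Real.exp u.re))) := by
            refine mul_le_mul (hQD _) ?_ (by positivity) (by positivity)
            refine mul_le_mul_of_nonneg_left (Real.exp_le_exp.2 ?_) (abs_nonneg _)
            nlinarith
        _ = (D * |G|) * Real.exp (-κ * Real.exp u.re) := by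
            rw [mul_mul_mul_comm, ← Real.exp_add, hn, hκ]
            congr 2
            ring
    nlinarith
  by_cases hx1 : u.re < x₁
  · have hlt : ‖exp u‖ < δ := by
      rw [hn, ← Real.lt_log_iff_exp_lt hδ]; simp only [x₁] at hx1; linarith
    have h4 := hpass {ω | ‖ω‖ < δ} (fun _ => |C₀|)
      (isOpen_lt continuous_norm continuous_const) continuous_const
      (fun ω hω hωV => (hzero ω hω hωV).trans (le_abs_self _)) u hu1 (hu2.trans_lt hθ1) hlt
    have h5 : ‖A (exp u)‖ ≤ (D * |C₀| * Real.exp (2 * κ * δ)) * Real.exp (-κ * Real.exp u.re) := by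
      refine h4.trans ((mul_le_mul_of_nonneg_right (hQD _) (abs_nonneg _)).trans ?_)
      rw [mul_right_comm, mul_assoc (D * |C₀|), ← Real.exp_add]
      refine mul_le_mul_of_nonneg_left (Real.exp_le_exp.2 ?_) (by positivity)
      rw [hn] at hlt ⊢
      nlinarith
    nlinarith
  · have h4 := hM u ⟨⟨not_lt.1 hx1, not_lt.1 hx2⟩, hu1, hu2⟩
    have h5 : ‖A (exp u)‖ ≤ (|M| * Real.exp (κ * Real.exp x₂)) * Real.exp (-κ * Real.exp u.re) := by
      refine (h4.trans (le_abs_self _)).trans ?_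
      rw [mul_assoc, ← Real.exp_add]
      refine le_mul_of_one_le_right (abs_nonneg _) (Real.one_le_exp ?_)
      have := Real.exp_le_exp.2 (not_lt.1 hx2)
      nlinarith
    nlinarith

/-! ### Exponential sums and their uniform limits -/

/-- `p` is a sum of `N` non-growing complex exponentials. -/
def IsExpSum (N : ℕ) (p : ℝ → ℂ) : Prop :=
  ∃ g ω : Fin N → ℂ, (∀ k, 0 ≤ (ω k).im) ∧ ∀ t, p t = ∑ k, g k * exp (I * ω k * t)

namespace IsExpSum

theorem zero : IsExpSum 0 fun _ => 0 := ⟨0, 0, fun k => k.elim0, fun t => by simp⟩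

theorem exp_mul (g : ℂ) {ω : ℂ} (hω : 0 ≤ ω.im) : IsExpSum 1 fun t => g * exp (I * ω * t) :=
  ⟨fun _ => g, fun _ => ω, fun _ => hω, fun t => by simp⟩

theorem add {M N : ℕ} {p q : ℝ → ℂ} (hp : IsExpSum M p) (hq : IsExpSum N q) :
    IsExpSum (M + N) fun t => p t + q t := by
  obtain ⟨g, ω, hω, hp⟩ := hp
  obtain ⟨g', ω', hω', hq⟩ := hq
  refine ⟨Fin.append g g', Fin.append ω ω', fun k => ?_, fun t => ?_⟩
  · refine Fin.addCases (fun i => ?_) (fun i => ?_) k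
    · simpa using hω i
    · simpa using hω' i
  · simp [Fin.sum_univ_add, hp, hq]

theorem const_mul {N : ℕ} {p : ℝ → ℂ} (hp : IsExpSum N p) (c : ℂ) :
    IsExpSum N fun t => c * p t := by
  obtain ⟨g, ω, hω, hp⟩ := hp
  exact ⟨fun k => c * g k, ω, hω, fun t => by simp [hp, Finset.mul_sum, mul_assoc]⟩

theorem sum {ι : Type*} (s : Finset ι) {N : ι → ℕ} {p : ι → ℝ → ℂ}
    (h : ∀ i ∈ s, IsExpSum (N i) (p i)) : IsExpSum (∑ i ∈ s, N i) fun t => ∑ i ∈ s, p i t := by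
  classical
  induction s using Finset.induction_on with
  | empty => simpa using zero
  | insert a s ha ih =>
    simp only [Finset.sum_insert ha]
    exact (h a (Finset.mem_insert_self _ _)).add
      (ih fun i hi => h i (Finset.mem_insert_of_mem hi))

theorem continuous {N : ℕ} {p : ℝ → ℂ} (hp : IsExpSum N p) : Continuous p := by
  obtain ⟨g, ω, -, hp⟩ := hp
  rw [show p = _ from funext hp]
  fun_prop

end IsExpSum

/-- `f` is a uniform limit on `[0, T]` of sums of `N` non-growing complex exponentials. -/
def IsExpSumLimit (T : ℝ) (N : ℕ) (f : ℝ → ℂ) : Prop :=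
  ∀ η : ℝ, 0 < η → ∃ p, IsExpSum N p ∧ ∀ t ∈ Set.Icc 0 T, ‖f t - p t‖ ≤ η

namespace IsExpSumLimit

variable {T : ℝ}

theorem of_isExpSum {N : ℕ} {p : ℝ → ℂ} (hp : IsExpSum N p) : IsExpSumLimit T N p :=
  fun η hη => ⟨p, hp, fun t _ => by simpa using hη.le⟩

theorem add {M N : ℕ} {p q : ℝ → ℂ} (hp : IsExpSumLimit T M p) (hq : IsExpSumLimit T N q) :
    IsExpSumLimit T (M + N) fun t => p t + q t := by
  intro η hη
  obtain ⟨p', hp', h1⟩ := hp (η / 2) (half_pos hη)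
  obtain ⟨q', hq', h2⟩ := hq (η / 2) (half_pos hη)
  refine ⟨_, hp'.add hq', fun t ht => ?_⟩
  rw [add_sub_add_comm]
  exact (norm_add_le _ _).trans (by linarith [h1 t ht, h2 t ht])

theorem const_mul {N : ℕ} {p : ℝ → ℂ} (hp : IsExpSumLimit T N p) (c : ℂ) :
    IsExpSumLimit T N fun t => c * p t := by
  intro η hη
  obtain ⟨p', hp', h1⟩ := hp (η / (‖c‖ + 1)) (by positivity)
  refine ⟨_, hp'.const_mul c, fun t ht => ?_⟩
  rw [← mul_sub, norm_mul]
  have := h1 t ht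
  rw [le_div_iff₀ (by positivity)] at this
  nlinarith [norm_nonneg (p t - p' t)]

theorem sum {ι : Type*} (s : Finset ι) {N : ι → ℕ} {p : ι → ℝ → ℂ}
    (h : ∀ i ∈ s, IsExpSumLimit T (N i) (p i)) :
    IsExpSumLimit T (∑ i ∈ s, N i) fun t => ∑ i ∈ s, p i t := by
  classical
  induction s using Finset.induction_on with
  | empty => simpa using of_isExpSum IsExpSum.zero
  | insert a s ha ih =>
    simp only [Finset.sum_insert ha]
    exact (h a (Finset.mem_insert_self _ _)).add
      (ih fun i hi => h i (Finset.mem_insert_of_mem hi))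

theorem of_limit {N : ℕ} {f : ℝ → ℂ}
    (h : ∀ η : ℝ, 0 < η → ∃ g, IsExpSumLimit T N g ∧ ∀ t ∈ Set.Icc 0 T, ‖f t - g t‖ ≤ η) :
    IsExpSumLimit T N f := by
  intro η hη
  obtain ⟨g, hg, h1⟩ := h (η / 2) (half_pos hη)
  obtain ⟨p, hp, h2⟩ := hg (η / 2) (half_pos hη)
  refine ⟨p, hp, fun t ht => ?_⟩
  rw [← sub_add_sub_cancel _ (g t)]
  exact (norm_add_le _ _).trans (by linarith [h1 t ht, h2 t ht])

/-- Polynomials times exponentials are limits of difference quotients of exponentials. -/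
theorem pow_mul_exp (T : ℝ) (l : ℕ) {a : ℂ} (ha : 0 ≤ a.im) :
    IsExpSumLimit T (2 ^ l) fun t => (t : ℂ) ^ l * exp (I * a * t) := by
  induction l generalizing a with
  | zero => simpa using of_isExpSum (T := T) (IsExpSum.exp_mul 1 ha)
  | succ l ih =>
    refine of_limit fun η hη => ?_
    set S := |T| + 1 with hS
    have hS0 : 1 ≤ S := by rw [hS]; linarith [abs_nonneg T]
    -- Difference quotient in the frequency with a real step `σ`, which keeps the imaginary part.
    -- The first bound gives `‖iσt‖ ≤ 1` for the Taylor estimate, the second makes the error `σ t ^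
    -- (l + 2)` at most `η`.
    set σ := min (1 / S) (η / S ^ (l + 2)) with hσ
    have hσ0 : 0 < σ := by positivity
    have hσ1 : σ * S ≤ 1 := by
      rw [← le_div_iff₀ (by positivity)]; exact min_le_left _ _
    have hσ2 : σ * S ^ (l + 2) ≤ η := by
      rw [← le_div_iff₀ (by positivity)]; exact min_le_right _ _
    have haσ : 0 ≤ (a + σ).im := by simpa using ha
    have hlim := ((ih haσ).const_mul (1 / (I * σ))).add ((ih ha).const_mul (-(1 / (I * σ))))
    rw [← mul_two, ← pow_succ] at hlim
    refine ⟨_, hlim, fun t ht => ?_⟩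
    have htS : t ≤ S := by rw [hS]; linarith [ht.2, le_abs_self T]
    have hIσ : I * (σ : ℂ) ≠ 0 := mul_ne_zero I_ne_zero (by exact_mod_cast hσ0.ne')
    have hsmall : ‖I * σ * t‖ = σ * t := by
      simp [abs_of_pos hσ0, abs_of_nonneg ht.1]
    have h1 := norm_exp_sub_one_sub_id_le (x := I * σ * t) (by rw [hsmall]; nlinarith)
    have he : exp (I * (a + σ) * t) = exp (I * a * t) * exp (I * σ * t) := by
      rw [← exp_add]; congr 1; ring
    have hexp : ‖exp (I * a * t)‖ ≤ 1 := by
      rw [norm_exp, Real.exp_le_one_iff]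
      simp
      nlinarith [ht.1]
    have key : (t : ℂ) ^ (l + 1) * exp (I * a * t) -
        (1 / (I * σ) * ((t : ℂ) ^ l * exp (I * (a + σ) * t)) +
          -(1 / (I * σ)) * ((t : ℂ) ^ l * exp (I * a * t))) =
        -((t : ℂ) ^ l * exp (I * a * t) * (1 / (I * σ)) *
          (exp (I * σ * t) - 1 - I * σ * t)) := by
      have hinv : 1 / (I * (σ : ℂ)) * (I * σ) = 1 := one_div_mul_cancel hIσ
      rw [he]
      linear_combination (-((t : ℂ) ^ (l + 1) * exp (I * a * t))) * hinv
    have key2 : ‖(t : ℂ) ^ l * exp (I * a * t) * (1 / (I * σ)) *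
          (exp (I * σ * t) - 1 - I * σ * t)‖ ≤ η := by
      rw [norm_mul, norm_mul, norm_mul, norm_pow, norm_real, Real.norm_of_nonneg ht.1]
      have : ‖1 / (I * (σ : ℂ))‖ = 1 / σ := by simp [abs_of_pos hσ0]
      rw [this]
      rw [hsmall] at h1
      calc t ^ l * ‖exp (I * a * t)‖ * (1 / σ) * ‖exp (I * σ * t) - 1 - I * σ * t‖
          ≤ t ^ l * 1 * (1 / σ) * (σ * t) ^ 2 := by
            have := ht.1
            gcongr
        _ = σ * t ^ (l + 2) := by field_simp; ring
        _ ≤ σ * S ^ (l + 2) := by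
            have := ht.1
            gcongr
        _ ≤ η := hσ2
    rw [key, norm_neg]
    exact key2

end IsExpSumLimit

/-! ### Hermite interpolation at the poles -/

/-- Hermite interpolation of `w ↦ exp (I * w * t)` at the nodes `Z`, each with multiplicity `m`. -/
theorem Complex.exists_exp_interpolation (Z : Finset ℂ) (hZ : Z.Nonempty) (m : ℕ) :
    ∃ (p : ℂ → ℕ → Polynomial ℂ) (R : ℝ → ℂ → ℂ), (∀ t, Differentiable ℂ (R t)) ∧
      (∀ κ t : ℝ, 0 < κ → 0 ≤ t → ∃ C, 0 ≤ C ∧ ∀ w : ℂ, 0 ≤ w.im →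
        ‖R t w‖ ≤ C * Real.exp (κ * ‖w‖)) ∧
      ∀ (t : ℝ) (w : ℂ), exp (I * w * t) =
        ∑ a ∈ Z, ∑ l ∈ Finset.range m, ((t : ℂ) ^ l * exp (I * a * t)) * (p a l).eval w +
          (∏ a ∈ Z, (w - a) ^ m) * R t w := by
  classical
  -- Bézout: `∑ μ_a ∏_{b ≠ a} (w - b)^m = 1`. In the summand of `a`, the exponential is Taylor
  -- expanded at `a` to order `m`; the factor `(w - a)^m` of the remainder completes the product.
  obtain ⟨μ, hμ⟩ := (exists_sum_eq_one_iff_pairwise_coprime (t := Z)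
    (s := fun a : ℂ => (Polynomial.X - Polynomial.C a) ^ m) hZ).2 (by
      intro a b hab
      exact (Polynomial.isCoprime_X_sub_C_of_isUnit_sub
        (sub_ne_zero.2 (fun h => hab (Subtype.ext h))).isUnit).pow)
  obtain ⟨c, φ, Cφ, hφ, hCφ, hφb, hexp⟩ := Complex.exists_exp_eq_sum_add_pow_mul m
  refine ⟨fun a l => Polynomial.C (c l * I ^ l) * (μ a * ∏ b ∈ Z \ {a},
      (Polynomial.X - Polynomial.C b) ^ m) * (Polynomial.X - Polynomial.C a) ^ l,
    fun t w => ∑ a ∈ Z, (μ a).eval w * ((I * t) ^ m * exp (I * a * t) * φ (I * t * (w - a))),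
    fun t => ?_, fun κ t hκ ht => ?_, fun t w => ?_⟩
  · refine Differentiable.fun_sum fun a _ => (Polynomial.differentiable _).mul
      ((differentiable_const _).mul (hφ.comp (by fun_prop)))
  · choose D hD hDb using fun a => Polynomial.norm_eval_le_exp (μ a) hκ
    refine ⟨∑ a ∈ Z, D a * (‖(I * t) ^ m * exp (I * a * t)‖ *
      (Cφ * (1 + Real.exp (t * a.im)))), Finset.sum_nonneg fun a _ => ?_, fun w hw => ?_⟩
    · have := hD a
      positivity
    · rw [Finset.sum_mul]
      refine (norm_sum_le _ _).trans (Finset.sum_le_sum fun a _ => ?_)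
      rw [norm_mul, norm_mul _ (φ _), mul_right_comm (D a)]
      -- The remainder bound sees only the real part of its argument, which is at most `t * a.im` in
      -- the closed upper half-plane.
      have h1 : ‖φ (I * t * (w - a))‖ ≤ Cφ * (1 + Real.exp (t * a.im)) := by
        refine (hφb _).trans ?_
        have : (I * t * (w - a)).re = -(t * w.im) + t * a.im := by simp; ring
        rw [this]
        have := mul_nonneg ht hw
        gcongr
        linarith
      have := hD a
      refine mul_le_mul (hDb a w) ?_ (by positivity) (by positivity)
      exact mul_le_mul_of_nonneg_left h1 (norm_nonneg _)
  · have hone : ∑ a ∈ Z, (μ a).eval w * ∏ b ∈ Z \ {a}, (w - b) ^ m = 1 := by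
      have := congrArg (Polynomial.eval w) hμ
      simpa [Polynomial.eval_finsetSum, Polynomial.eval_prod] using this
    have hterm : ∀ a ∈ Z, (μ a).eval w * (∏ b ∈ Z \ {a}, (w - b) ^ m) * exp (I * w * t) =
        ∑ l ∈ Finset.range m, ((t : ℂ) ^ l * exp (I * a * t)) *
          (Polynomial.C (c l * I ^ l) * (μ a * ∏ b ∈ Z \ {a},
            (Polynomial.X - Polynomial.C b) ^ m) * (Polynomial.X - Polynomial.C a) ^ l).eval w +
        (∏ a ∈ Z, (w - a) ^ m) *
          ((μ a).eval w * ((I * t) ^ m * exp (I * a * t) * φ (I * t * (w - a)))) := by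
      intro a ha
      have e1 : exp (I * w * t) = exp (I * a * t) * exp (I * t * (w - a)) := by
        rw [← exp_add]; congr 1; ring
      have e2 : ∏ b ∈ Z, (w - b) ^ m = (w - a) ^ m * ∏ b ∈ Z \ {a}, (w - b) ^ m := by
        rw [Finset.sdiff_singleton_eq_erase, Finset.mul_prod_erase Z (fun b => (w - b) ^ m) ha]
      rw [e1, e2, hexp (I * t * (w - a)), mul_add, mul_add]
      congr 1
      · rw [Finset.mul_sum, Finset.mul_sum]
        refine Finset.sum_congr rfl fun l _ => ?_
        simp only [Polynomial.eval_mul, Polynomial.eval_C, Polynomial.eval_prod,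
          Polynomial.eval_pow, Polynomial.eval_sub, Polynomial.eval_X, mul_pow]
        ring
      · rw [mul_pow (I * (t : ℂ)) (w - a)]
        ring
    calc exp (I * w * t)
        = (∑ a ∈ Z, (μ a).eval w * ∏ b ∈ Z \ {a}, (w - b) ^ m) * exp (I * w * t) := by
          rw [hone, one_mul]
      _ = _ := by
          rw [Finset.sum_mul, Finset.sum_congr rfl hterm, Finset.sum_add_distrib,
            ← Finset.mul_sum]

/-- A polynomial without zeros on a ray is bounded away from zero there. -/
theorem Complex.exists_le_norm_prod_ray (Z : Finset ℂ) (m : ℕ) {θ : ℝ} (hθ0 : 0 ≤ θ)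
    (hθ1 : θ < Real.pi) (hZ : ∀ a ∈ Z, 0 < a.arg ∧ a.arg < Real.pi ∧ a.arg ≠ θ) :
    ∃ c, 0 < c ∧ ∀ x : ℝ, c ≤ ‖∏ a ∈ Z, (exp (x + θ * I) - a) ^ m‖ := by
  -- Each factor is a power of the distance from `a` to the line carrying the ray.
  refine ⟨∏ a ∈ Z, |(a * exp (-(θ * I))).im| ^ m, Finset.prod_pos fun a ha => ?_, fun x => ?_⟩
  · obtain ⟨h1, h2, h3⟩ := hZ a ha
    refine pow_pos (abs_pos.2 ?_) _
    have ha0 : a ≠ 0 := by rintro rfl; simp at h1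
    have : (a * exp (-(θ * I))).im = ‖a‖ * Real.sin (a.arg - θ) := by
      conv_lhs => rw [← norm_mul_exp_arg_mul_I a, mul_assoc, ← exp_add]
      rw [im_ofReal_mul, ← sub_eq_add_neg, ← sub_mul, ← ofReal_sub, exp_ofReal_mul_I_im]
    rw [this]
    refine mul_ne_zero (norm_ne_zero_iff.2 ha0) ?_
    rcases lt_or_gt_of_ne h3 with h | h
    · exact (Real.sin_neg_of_neg_of_neg_pi_lt (by linarith) (by linarith)).ne
    · exact (Real.sin_pos_of_pos_of_lt_pi (by linarith) (by linarith)).ne'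
  · rw [norm_prod]
    refine Finset.prod_le_prod (fun a _ => by positivity) fun a _ => ?_
    rw [norm_pow]
    refine pow_le_pow_left₀ (abs_nonneg _) ?_ _
    have h1 : ‖exp (x + θ * I) - a‖ = ‖(a * exp (-(θ * I)) - Real.exp x)‖ := by
      have : exp (x + θ * I) - a = -(exp (θ * I) * (a * exp (-(θ * I)) - Real.exp x)) := by
        rw [mul_sub, mul_left_comm, ← exp_add, add_neg_cancel, exp_zero, exp_add, ofReal_exp]
        ring
      rw [this, norm_neg, norm_mul, norm_exp_ofReal_mul_I, one_mul]
    rw [h1]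
    refine le_trans (le_of_eq ?_) (abs_im_le_norm _)
    rw [sub_im, ofReal_im, sub_zero]

/-- Since `Im a > 0`, each `t^l e^{iat}` decays exponentially. Only the rate `1 / (1 + t)` is kept,
which matches the ray integrals of `e^{iωt}`. -/
theorem exists_norm_sum_pow_mul_exp_le (Z : Finset ℂ) (hZ : ∀ a ∈ Z, 0 < a.im) (m : ℕ)
    (p : ℂ → ℕ → Polynomial ℂ) {κ : ℝ} (hκ : 0 < κ) :
    ∃ C, 0 ≤ C ∧ ∀ (t : ℝ) (w : ℂ), 0 ≤ t →
      ‖∑ a ∈ Z, ∑ l ∈ Finset.range m, ((t : ℂ) ^ l * exp (I * a * t)) * (p a l).eval w‖ ≤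
        C / (1 + t) * Real.exp (κ * ‖w‖) := by
  choose D hD hDb using fun a l => Polynomial.norm_eval_le_exp (p a l) hκ
  have h1 : ∀ a : Z, ∀ l : ℕ, ∃ C, 0 ≤ C ∧ ∀ t : ℝ, 0 ≤ t →
      t ^ l * Real.exp (-(a : ℂ).im * t) ≤ C / (1 + t) :=
    fun a l => Real.pow_mul_exp_neg_le l (hZ a a.2)
  choose B hB hBb using h1
  refine ⟨∑ a : Z, ∑ l ∈ Finset.range m, B a l * D a l,
    Finset.sum_nonneg fun a _ => Finset.sum_nonneg fun l _ => mul_nonneg (hB a l) (hD a l),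
    fun t w ht => ?_⟩
  rw [← Finset.sum_coe_sort Z, Finset.sum_div, Finset.sum_mul]
  refine (norm_sum_le _ _).trans (Finset.sum_le_sum fun a _ => ?_)
  rw [Finset.sum_div, Finset.sum_mul]
  refine (norm_sum_le _ _).trans (Finset.sum_le_sum fun l _ => ?_)
  rw [norm_mul, mul_div_right_comm, mul_assoc (B a l / (1 + t))]
  have h2 : ‖(t : ℂ) ^ l * exp (I * a * t)‖ ≤ B a l / (1 + t) := by
    refine le_trans (le_of_eq ?_) (hBb a l t ht)
    rw [norm_mul, norm_pow, norm_real, Real.norm_of_nonneg ht, norm_exp]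
    simp
  exact mul_le_mul h2 (hDb a l w) (norm_nonneg _) ((norm_nonneg _).trans h2)

/-! ### Quadrature on a rotated ray -/

open MeasureTheory in
theorem integral_Ioi_eq_integral_exp (g : ℝ → ℂ) :
    ∫ x in Set.Ioi 0, g x = ∫ x : ℝ, Real.exp x * g (Real.exp x) := by
  have := integral_image_eq_integral_abs_deriv_smul (s := Set.univ) (f := Real.exp)
    (f' := Real.exp) MeasurableSet.univ (fun x _ => (Real.hasDerivAt_exp x).hasDerivWithinAt)
    Real.exp_injective.injOn g
  rw [Set.image_univ, Real.range_exp, Measure.restrict_univ] at this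
  rw [this]
  simp [Complex.real_smul]

-- Because `∫ e^x exp (-k e^x) dx = 1 / k`, the damping `k = κ + tσ` turns into the decay `1 / (1 +
-- t)`, which later makes the quadrature error cost `log (1 + T)` instead of `T`.
open MeasureTheory in
theorem integral_le_of_ray_bound {f : ℝ → ℂ} {K κ σ t : ℝ} (hK : 0 ≤ K) (hκ : 0 < κ) (hσ : 0 < σ)
    (ht : 0 ≤ t)
    (hf : ∀ x, ‖f x‖ ≤ K * (Real.exp x * Real.exp (-(κ + t * σ) * Real.exp x) +
      1 / (1 + t) * (Real.exp x * Real.exp (-(κ / 2) * Real.exp x)))) :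
    ∫ x : ℝ, ‖f x‖ ≤ K * (1 / κ + 1 / σ + 2 / κ) / (1 + t) := by
  have hκt : 0 < κ + t * σ := by positivity
  obtain ⟨i1, e1⟩ := integrable_exp_mul_exp_neg_exp hκt
  obtain ⟨i2, e2⟩ := integrable_exp_mul_exp_neg_exp (half_pos hκ)
  have hi := (i1.add (i2.const_mul (1 / (1 + t)))).const_mul K
  refine (integral_mono_of_nonneg (Filter.Eventually.of_forall fun x => norm_nonneg _) hi
    (Filter.Eventually.of_forall hf)).trans ?_
  simp only [Pi.add_apply]
  rw [integral_const_mul, integral_add i1 (i2.const_mul _), integral_const_mul, e1, e2, mul_div_assoc]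
  refine mul_le_mul_of_nonneg_left ?_ hK
  have h1 : 1 / (κ + t * σ) ≤ (1 / κ + 1 / σ) / (1 + t) := by
    rw [div_le_div_iff₀ hκt (by positivity)]
    have : (1 / κ + 1 / σ) * (κ + t * σ) = 1 + t + t * (σ / κ) + κ / σ := by
      field_simp; ring
    rw [this]
    have : 0 ≤ t * (σ / κ) := by positivity
    have : 0 ≤ κ / σ := by positivity
    linarith
  rw [add_div (1 / κ + 1 / σ)]
  refine add_le_add h1 (le_of_eq ?_)
  field_simp

set_option maxHeartbeats 800000 in
open MeasureTheory in
/-- Exponential-sum approximation of the Fourier integral of `A / ∏ (x - a) ^ m` over the positive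
half-line, when `A` is analytic and exponentially decaying in a sector. -/
theorem exists_expSum_approx_integral (Z : Finset ℂ) (hZ : Z.Nonempty) (m : ℕ)
    {θ d κ C : ℝ} (hθ : 0 < θ) (hd : 0 < d) (hθd : θ + 2 * d < Real.pi / 2)
    (hZarg : ∀ a ∈ Z, 0 < a.arg ∧ a.arg < Real.pi ∧
      a.arg ≠ θ ∧ a.arg ≠ θ + d ∧ a.arg ≠ θ + 2 * d) (hκ : 0 < κ) (hC : 0 ≤ C) :
    ∃ (K : ℝ) (M : ℕ), 0 ≤ K ∧ ∀ A : ℂ → ℂ,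
      ContinuousOn (fun u => A (exp u)) {u | 0 ≤ u.im ∧ u.im ≤ θ + 2 * d} →
      DifferentiableOn ℂ (fun u => A (exp u)) {u | 0 < u.im ∧ u.im < θ + 2 * d} →
      (∀ u : ℂ, 0 ≤ u.im → u.im ≤ θ + 2 * d →
        ‖A (exp u)‖ ≤ C * Real.exp (-κ * Real.exp u.re)) →
      ∀ h, 0 < h → h ≤ 1 → Real.exp (-2 * Real.pi * d / h) ≤ 1 / 2 → ∀ N₁ N₂ : ℕ,
        ∃ p q : ℝ → ℂ, IsExpSum (N₁ + N₂) p ∧ (∀ T, IsExpSumLimit T M q) ∧ ∀ t : ℝ, 0 ≤ t →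
          ‖(∫ x : ℝ in Set.Ioi 0, A x / (∏ a ∈ Z, ((x : ℂ) - a) ^ m) * exp (I * x * t)) -
              (p t + q t)‖ ≤
            K * (Real.exp (-2 * Real.pi * d / h) / (1 + t) + Real.exp (-(N₁ * h)) +
              Real.exp (-(κ / 4) * Real.exp (N₂ * h))) := by
  have hπ := Real.pi_pos
  have hZim : ∀ a ∈ Z, 0 < a.im := fun a ha => im_pos_of_arg_pos (hZarg a ha).1 (hZarg a ha).2.1
  obtain ⟨P, R, hR, hRb, hid⟩ := exists_exp_interpolation Z hZ m
  obtain ⟨CH, hCH, hHb⟩ := exists_norm_sum_pow_mul_exp_le Z hZim m P (half_pos hκ)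
  set Q : ℂ → ℂ := fun w => ∏ a ∈ Z, (w - a) ^ m with hQ
  set H : ℝ → ℂ → ℂ := fun t w =>
    ∑ a ∈ Z, ∑ l ∈ Finset.range m, ((t : ℂ) ^ l * exp (I * a * t)) * (P a l).eval w with hH
  obtain ⟨c₀, hc₀, hQ₀⟩ := exists_le_norm_prod_ray Z m (θ := 0) le_rfl hπ
    (fun a ha => ⟨(hZarg a ha).1, (hZarg a ha).2.1, (hZarg a ha).1.ne'⟩)
  obtain ⟨c₁, hc₁, hQ₁⟩ := exists_le_norm_prod_ray Z m (θ := θ) hθ.le (by linarith)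
    (fun a ha => ⟨(hZarg a ha).1, (hZarg a ha).2.1, (hZarg a ha).2.2.1⟩)
  obtain ⟨c₂, hc₂, hQ₂⟩ := exists_le_norm_prod_ray Z m (θ := θ + d) (by linarith) (by linarith)
    (fun a ha => ⟨(hZarg a ha).1, (hZarg a ha).2.1, (hZarg a ha).2.2.2.1⟩)
  obtain ⟨c₃, hc₃, hQ₃⟩ := exists_le_norm_prod_ray Z m (θ := θ + 2 * d) (by linarith) (by linarith)
    (fun a ha => ⟨(hZarg a ha).1, (hZarg a ha).2.1, (hZarg a ha).2.2.2.2⟩)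
  -- `C / c` bounds the prefactor of `A / Q` on a ray where `c ≤ ‖Q‖`; `1 + CH` accounts for
  -- `e^{iωt}` and its interpolant.
  set K₀ : ℝ → ℝ := fun c => C / c * (1 + CH) with hK₀
  have hK₀n : ∀ c, 0 < c → 0 ≤ K₀ c := fun c hc => by simp only [hK₀]; positivity
  set B : ℝ → ℝ → ℝ := fun c σ => K₀ c * (1 / κ + 1 / σ + 2 / κ) with hB
  have hs₁ : 0 < Real.sin θ := Real.sin_pos_of_pos_of_lt_pi hθ (by linarith)
  have hs₃ : 0 < Real.sin (θ + 2 * d) := Real.sin_pos_of_pos_of_lt_pi (by linarith) (by linarith)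
  have hBn : ∀ c σ, 0 < c → 0 < σ → 0 ≤ B c σ := fun c σ hc hσ => by
    have := hK₀n c hc
    simp only [hB]; positivity
  set B₀ := B c₁ (Real.sin θ) + B c₃ (Real.sin (θ + 2 * d)) with hB₀
  have hB₀n : 0 ≤ B₀ := add_nonneg (hBn _ _ hc₁ hs₁) (hBn _ _ hc₃ hs₃)
  set K₂ := 2 * K₀ c₂ * (2 + 16 / (κ / 2) ^ 2) with hK₂
  have hK₂n : 0 ≤ K₂ := by
    have := hK₀n c₂ hc₂
    positivity
  -- The constants are fixed before `A`; as `A` will contain the occupation factor, this gives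
  -- uniformity in `β`. The second one counts the exponentials that stand for the pole terms.
  refine ⟨4 * B₀ + K₂, ∑ a ∈ Z, ∑ l ∈ Finset.range m, 2 ^ l, by positivity,
    fun A hAc hAd hAb h hh0 hh1 hq N₁ N₂ => ?_⟩
  set F : ℂ → ℂ := fun w => A w / Q w with hF
  -- the integrand in logarithmic coordinates
  set f : ℝ → ℂ → ℂ := fun t u => A (exp u) * R t (exp u) * exp u with hf
  have hfray : ∀ (t : ℝ) (u : ℂ), Q (exp u) ≠ 0 →
      f t u = F (exp u) * exp u * (exp (I * exp u * t) - H t (exp u)) := by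
    intro t u hu
    rw [hid t (exp u)]
    simp only [hf, hF, hH, hQ] at hu ⊢
    rw [add_sub_cancel_left]
    field_simp
  have hray : ∀ (α c : ℝ), 0 ≤ α → α ≤ θ + 2 * d → 0 < c →
      (∀ x : ℝ, c ≤ ‖Q (exp (x + α * I))‖) → ∀ t : ℝ, 0 ≤ t → ∀ x : ℝ,
      ‖f t (x + α * I)‖ ≤ K₀ c * (Real.exp x * Real.exp (-(κ + t * Real.sin α) * Real.exp x) +
        1 / (1 + t) * (Real.exp x * Real.exp (-(κ / 2) * Real.exp x))) := by
    intro α c hα0 hα1 hc hQc t ht x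
    have hQne : Q (exp (x + α * I)) ≠ 0 := norm_pos_iff.1 (hc.trans_le (hQc x))
    have hn : ‖exp (x + α * I)‖ = Real.exp x := by rw [norm_exp]; simp
    have him : (exp (x + α * I)).im = Real.exp x * Real.sin α := by rw [exp_im]; simp
    have hE : ‖exp (I * exp (x + α * I) * t)‖ = Real.exp (-(t * Real.sin α) * Real.exp x) := by
      rw [norm_exp]
      congr 1
      rw [re_mul_ofReal, I_mul_re, him]
      ring
    have hA1 := hAb (x + α * I) (by simpa using hα0) (by simpa using hα1)
    have hH1 := hHb t (exp (x + α * I)) ht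
    rw [hn] at hH1
    rw [hfray t _ hQne, norm_mul, norm_mul, hn]
    have hF1 : ‖F (exp (x + α * I))‖ ≤ C / c * Real.exp (-κ * Real.exp x) := by
      rw [hF, norm_div, div_mul_eq_mul_div]
      refine div_le_div₀ (by positivity) (by simpa using hA1) hc (hQc x)
    have hsub : ‖exp (I * exp (x + α * I) * t) - H t (exp (x + α * I))‖ ≤
        Real.exp (-(t * Real.sin α) * Real.exp x) +
          CH / (1 + t) * Real.exp (κ / 2 * Real.exp x) := by
      refine (norm_sub_le _ _).trans (add_le_add hE.le hH1)
    have e1 : Real.exp (-(κ + t * Real.sin α) * Real.exp x) =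
        Real.exp (-κ * Real.exp x) * Real.exp (-(t * Real.sin α) * Real.exp x) := by
      rw [← Real.exp_add]; congr 1; ring
    have e2 : Real.exp (-(κ / 2) * Real.exp x) =
        Real.exp (-κ * Real.exp x) * Real.exp (κ / 2 * Real.exp x) := by
      rw [← Real.exp_add]; congr 1; ring
    rw [e1, e2]
    refine (mul_le_mul (mul_le_mul_of_nonneg_right hF1 (Real.exp_pos _).le) hsub (norm_nonneg _)
      (by positivity)).trans ?_
    set y := Real.exp x
    set a₁ := Real.exp (-κ * y)
    set a₂ := Real.exp (-(t * Real.sin α) * y)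
    set a₃ := Real.exp (κ / 2 * y)
    have p1 : 0 ≤ C / c * a₁ * y * a₂ := by positivity
    have p2 : 0 ≤ C / c * a₁ * y * a₃ / (1 + t) := by positivity
    have : K₀ c * (y * (a₁ * a₂) + 1 / (1 + t) * (y * (a₁ * a₃))) =
        C / c * a₁ * y * (a₂ + CH / (1 + t) * a₃) + CH * (C / c * a₁ * y * a₂) +
          C / c * a₁ * y * a₃ / (1 + t) := by
      simp only [hK₀]; ring
    rw [this]
    have := mul_nonneg hCH p1
    linarith
  have hfc : ∀ t, ContinuousOn (f t) {u | 0 ≤ u.im ∧ u.im ≤ θ + 2 * d} := fun t =>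
    (hAc.mul ((hR t).continuous.comp continuous_exp).continuousOn).mul continuous_exp.continuousOn
  have hfd : ∀ t, DifferentiableOn ℂ (f t) {u | 0 < u.im ∧ u.im < θ + 2 * d} := fun t =>
    (hAd.mul ((hR t).comp differentiable_exp).differentiableOn).mul
      differentiable_exp.differentiableOn
  -- This constant depends on `t`; it only legitimates contour shifts and Poisson summation and does
  -- not enter the final bound.
  have hfb : ∀ t : ℝ, 0 ≤ t → ∃ C', ∀ u : ℂ, 0 ≤ u.im → u.im ≤ θ + 2 * d →
      ‖f t u‖ ≤ C' * Real.exp (-|u.re|) := by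
    intro t ht
    obtain ⟨D, hD, hDb⟩ := hRb (κ / 2) t (half_pos hκ) ht
    refine ⟨C * D * (1 + 2 / (κ / 2) ^ 2), fun u hu1 hu2 => ?_⟩
    have him : 0 ≤ (exp u).im := by
      rw [exp_im]
      exact mul_nonneg (Real.exp_pos _).le
        (Real.sin_nonneg_of_nonneg_of_le_pi hu1 (by linarith))
    have h1 := hDb (exp u) him
    rw [norm_exp] at h1
    rw [hf, norm_mul, norm_mul, norm_exp]
    calc ‖A (exp u)‖ * ‖R t (exp u)‖ * Real.exp u.re
        ≤ (C * Real.exp (-κ * Real.exp u.re)) * (D * Real.exp (κ / 2 * Real.exp u.re)) *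
            Real.exp u.re := by
          refine mul_le_mul_of_nonneg_right ?_ (Real.exp_pos _).le
          exact mul_le_mul (hAb u hu1 hu2) h1 (norm_nonneg _) (by positivity)
      _ = C * D * (Real.exp u.re * Real.exp (-(κ / 2) * Real.exp u.re)) := by
          have : Real.exp (-(κ / 2) * Real.exp u.re) =
              Real.exp (-κ * Real.exp u.re) * Real.exp (κ / 2 * Real.exp u.re) := by
            rw [← Real.exp_add]; congr 1; ring
          rw [this]; ring
      _ ≤ C * D * (1 + 2 / (κ / 2) ^ 2) * Real.exp (-|u.re|) := by
          rw [mul_assoc (C * D)]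
          exact mul_le_mul_of_nonneg_left (Real.exp_mul_exp_neg_exp_le (half_pos hκ) _)
            (by positivity)
  have hQreal : ∀ x : ℝ, 0 < x → c₀ ≤ ‖Q x‖ := by
    intro x hx
    have := hQ₀ (Real.log x)
    simpa [← ofReal_exp, Real.exp_log hx, hQ] using this
  have hAreal : ∀ x : ℝ, 0 < x → ‖A x‖ ≤ C * Real.exp (-κ * x) := by
    intro x hx
    have := hAb (Real.log x) (by simp) (by simp; linarith)
    simpa [← ofReal_exp, Real.exp_log hx] using this
  have hAcreal : ContinuousOn (fun x : ℝ => A x) (Set.Ioi 0) := by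
    have h1 : ContinuousOn (fun x : ℝ => A (exp (Real.log x : ℂ))) (Set.Ioi 0) := by
      refine hAc.comp (f := fun x : ℝ => (Real.log x : ℂ)) ?_ ?_
      · exact continuous_ofReal.comp_continuousOn
          (Real.continuousOn_log.mono fun x hx => (Set.mem_Ioi.1 hx).ne')
      · intro x _
        refine ⟨by simp, ?_⟩
        rw [ofReal_im]; linarith
    refine h1.congr fun x hx => ?_
    beta_reduce
    rw [← ofReal_exp, Real.exp_log hx]
  have hInt : ∀ (g : ℂ → ℂ) (D : ℝ), Continuous g →
      (∀ x : ℝ, 0 < x → ‖g x‖ ≤ D * Real.exp (κ / 2 * x)) →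
      IntegrableOn (fun x : ℝ => F x * g x) (Set.Ioi 0) := by
    intro g D hg hgD
    have hD0 : 0 ≤ D := by
      have := (norm_nonneg _).trans (hgD 1 one_pos)
      exact nonneg_of_mul_nonneg_left this (Real.exp_pos _)
    have hi : IntegrableOn (fun x : ℝ => C / c₀ * D * Real.exp (-(κ / 2) * x)) (Set.Ioi 0) :=
      (integrableOn_exp_mul_Ioi (by linarith) 0).const_mul _
    refine hi.mono' ?_ ?_
    · refine ContinuousOn.aestronglyMeasurable ?_ measurableSet_Ioi
      refine ContinuousOn.mul (ContinuousOn.div hAcreal ?_ fun x hx =>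
        norm_pos_iff.1 (hc₀.trans_le (hQreal x hx))) (hg.comp continuous_ofReal).continuousOn
      simp only [hQ]
      fun_prop
    · refine (ae_restrict_iff' measurableSet_Ioi).2 (Filter.Eventually.of_forall fun x hx => ?_)
      have hx' : 0 < x := hx
      rw [norm_mul, hF, norm_div]
      have e : Real.exp (-(κ / 2) * x) = Real.exp (-κ * x) * Real.exp (κ / 2 * x) := by
        rw [← Real.exp_add]; congr 1; ring
      calc ‖A x‖ / ‖Q x‖ * ‖g x‖
          ≤ (C * Real.exp (-κ * x)) / c₀ * (D * Real.exp (κ / 2 * x)) := by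
            refine mul_le_mul ?_ (hgD x hx') (norm_nonneg _) (by positivity)
            exact div_le_div₀ (by positivity) (hAreal x hx') hc₀ (hQreal x hx')
        _ = C / c₀ * D * Real.exp (-(κ / 2) * x) := by rw [e]; ring
  have hintP : ∀ a l, IntegrableOn (fun x : ℝ => F x * (P a l).eval (x : ℂ)) (Set.Ioi 0) := by
    intro a l
    obtain ⟨D, -, hDb⟩ := (P a l).norm_eval_le_exp (half_pos hκ)
    refine hInt (fun w => (P a l).eval w) D (P a l).continuous fun x hx => ?_
    simpa [abs_of_pos hx] using hDb x
  set J : ℂ → ℕ → ℂ := fun a l => ∫ x : ℝ in Set.Ioi 0, F x * (P a l).eval (x : ℂ) with hJ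
  -- The interpolant contributes pole terms with coefficients `J a l`, integrated on the real axis;
  -- only the remainder `A R_t` is left to be rotated.
  have hsplit : ∀ t : ℝ, 0 ≤ t → ∫ x : ℝ in Set.Ioi 0, F x * exp (I * x * t) =
      (∑ a ∈ Z, ∑ l ∈ Finset.range m, ((t : ℂ) ^ l * exp (I * a * t)) * J a l) +
        ∫ x : ℝ, f t (x + (0 : ℝ) * I) := by
    intro t ht
    have hE : IntegrableOn (fun x : ℝ => F x * exp (I * x * t)) (Set.Ioi 0) := by
      refine hInt (fun w => exp (I * w * t)) 1 (by fun_prop) fun x hx => ?_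
      rw [norm_exp, one_mul]
      refine Real.exp_le_exp.2 ?_
      have : (I * x * t : ℂ).re = 0 := by simp
      rw [this]; positivity
    have hHint : ∀ a ∈ Z, ∀ l ∈ Finset.range m, IntegrableOn (fun x : ℝ =>
        ((t : ℂ) ^ l * exp (I * a * t)) * (F x * (P a l).eval (x : ℂ))) (Set.Ioi 0) :=
      fun a _ l _ => (hintP a l).const_mul _
    have hHeq : ∀ x : ℝ, F x * H t x = ∑ a ∈ Z, ∑ l ∈ Finset.range m,
        ((t : ℂ) ^ l * exp (I * a * t)) * (F x * (P a l).eval (x : ℂ)) := by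
      intro x
      simp only [hH, Finset.mul_sum]
      refine Finset.sum_congr rfl fun a _ => Finset.sum_congr rfl fun l _ => by ring
    have hHI : ∫ x : ℝ in Set.Ioi 0, F x * H t x =
        ∑ a ∈ Z, ∑ l ∈ Finset.range m, ((t : ℂ) ^ l * exp (I * a * t)) * J a l := by
      simp_rw [hHeq]
      rw [integral_finsetSum _ fun a ha => integrable_finsetSum _ (hHint a ha)]
      refine Finset.sum_congr rfl fun a ha => ?_
      rw [integral_finsetSum _ (hHint a ha)]
      refine Finset.sum_congr rfl fun l _ => ?_
      rw [integral_const_mul]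
    have hHi : IntegrableOn (fun x : ℝ => F x * H t x) (Set.Ioi 0) := by
      simp_rw [hHeq]
      exact integrable_finsetSum _ fun a ha => integrable_finsetSum _ (hHint a ha)
    rw [← hHI, ← sub_eq_iff_eq_add', ← integral_sub hE hHi, integral_Ioi_eq_integral_exp]
    congr 1
    ext x
    have hQx : Q (exp (x : ℂ)) ≠ 0 := by
      have := hQreal _ (Real.exp_pos x)
      rw [ofReal_exp] at this
      exact norm_pos_iff.1 (hc₀.trans_le this)
    rw [ofReal_zero, zero_mul, add_zero, hfray t _ hQx]
    push_cast
    ring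
  -- the quadrature nodes
  set S := (Finset.range N₂).disjSum (Finset.range N₁) with hS
  set e : ℕ ⊕ ℕ → ℤ := Sum.elim (fun i => (i : ℤ)) (fun i => -((i : ℤ) + 1)) with he
  set node : ℤ → ℂ := fun n => ((n * h : ℝ) : ℂ) + (θ + d : ℝ) * I with hnode
  set W : ℤ → ℂ := fun n => F (exp (node n)) * exp (node n) with hW
  have hSsum : ∀ c : ℤ → ℂ, ∑ j ∈ S, c (e j) =
      ∑ i ∈ Finset.range N₂, c i + ∑ i ∈ Finset.range N₁, c (-(i + 1)) := by
    intro c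
    rw [hS, Finset.sum_disjSum]
    rfl
  have hnodeQ : ∀ n, Q (exp (node n)) ≠ 0 := fun n => norm_pos_iff.1 (hc₂.trans_le (hQ₂ _))
  -- At a node, `f t` is an exponential minus its interpolant. The exponentials form `p`; the
  -- interpolants are merged with the `J a l` into `q`, at no cost in the number of terms.
  refine ⟨fun t => ∑ j ∈ S, (h * W (e j)) * exp (I * exp (node (e j)) * t),
    fun t => ∑ a ∈ Z, ∑ l ∈ Finset.range m,
      (J a l - h * ∑ j ∈ S, W (e j) * (P a l).eval (exp (node (e j)))) *
        ((t : ℂ) ^ l * exp (I * a * t)), ?_, ?_, ?_⟩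
  · have hcard : ∑ _j ∈ S, 1 = N₁ + N₂ := by
      rw [Finset.sum_const, smul_eq_mul, mul_one, hS, Finset.card_disjSum, Finset.card_range,
        Finset.card_range, add_comm]
    rw [← hcard]
    refine IsExpSum.sum S fun j _ => IsExpSum.exp_mul _ ?_
    rw [exp_im]
    refine mul_nonneg (Real.exp_pos _).le (Real.sin_nonneg_of_nonneg_of_le_pi ?_ ?_) <;>
    · simp [hnode]; linarith
  · intro T
    exact IsExpSumLimit.sum Z fun a ha => IsExpSumLimit.sum _ fun l _ =>
      (IsExpSumLimit.pow_mul_exp T l (hZim a ha).le).const_mul _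
  · intro t ht
    obtain ⟨C', hC'⟩ := hfb t ht
    -- Rotation to the angle `θ + d`, the centre of the strip bounded by the rays `θ` and `θ + 2 *
    -- d`. Starting at `θ > 0` gives damping in `t` on both boundary rays.
    have hshift : ∫ x : ℝ, f t (x + (0 : ℝ) * I) = ∫ x : ℝ, f t (x + (θ + d : ℝ) * I) :=
      integral_horizontal_line_eq (by linarith)
        ((hfc t).mono fun u hu => ⟨hu.1, by linarith [hu.2]⟩)
        ((hfd t).mono fun u hu => ⟨hu.1, by linarith [hu.2]⟩)
        (fun u hu1 hu2 => hC' u hu1 (by linarith))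
    have hI₁ : ∫ x : ℝ, ‖f t (x + (θ + d - d : ℝ) * I)‖ ≤ B₀ / (1 + t) := by
      rw [add_sub_cancel_right]
      refine (integral_le_of_ray_bound (hK₀n c₁ hc₁) hκ hs₁ ht
        (hray θ c₁ hθ.le (by linarith) hc₁ hQ₁ t ht)).trans ?_
      refine div_le_div_of_nonneg_right ?_ (by linarith)
      exact le_add_of_nonneg_right (hBn _ _ hc₃ hs₃)
    have hI₃ : ∫ x : ℝ, ‖f t (x + (θ + d + d : ℝ) * I)‖ ≤ B₀ / (1 + t) := by
      rw [show θ + d + d = θ + 2 * d by ring]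
      refine (integral_le_of_ray_bound (hK₀n c₃ hc₃) hκ hs₃ ht
        (hray (θ + 2 * d) c₃ (by linarith) le_rfl hc₃ hQ₃ t ht)).trans ?_
      refine div_le_div_of_nonneg_right ?_ (by linarith)
      exact le_add_of_nonneg_left (hBn _ _ hc₁ hs₁)
    have htrap := norm_trapezoid_sub_integral_le (f := f t) (a := θ + d) (h := h) (C := C') hd hh0
      ((hfc t).mono fun u hu => ⟨by linarith [hu.1], by linarith [hu.2]⟩)
      ((hfd t).mono fun u hu => ⟨by linarith [hu.1], by linarith [hu.2]⟩)
      (fun u hu1 hu2 => hC' u (by linarith) (by linarith)) hI₁ hI₃ hq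
    have hterm : ∀ n : ℤ, ‖f t (node n)‖ ≤ 2 * K₀ c₂ *
        (Real.exp (n * h) * Real.exp (-(κ / 2) * Real.exp (n * h))) := by
      intro n
      refine (hray (θ + d) c₂ (by linarith) (by linarith) hc₂ hQ₂ t ht (n * h)).trans ?_
      set y := Real.exp (n * h)
      have hy : 0 < y := Real.exp_pos _
      have hs2 : 0 ≤ Real.sin (θ + d) := Real.sin_nonneg_of_nonneg_of_le_pi (by linarith) (by linarith)
      have g1 : Real.exp (-(κ + t * Real.sin (θ + d)) * y) ≤ Real.exp (-(κ / 2) * y) := by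
        refine Real.exp_le_exp.2 ?_
        have := mul_nonneg (mul_nonneg ht hs2) hy.le
        nlinarith
      have g2 : 1 / (1 + t) ≤ 1 := by rw [div_le_one (by linarith)]; linarith
      have g3 : 0 ≤ y * Real.exp (-(κ / 2) * y) := by positivity
      have g4 := mul_le_mul_of_nonneg_left g1 hy.le
      have g5 := mul_le_mul_of_nonneg_right g2 g3
      have := hK₀n c₂ hc₂
      calc _ ≤ K₀ c₂ * (y * Real.exp (-(κ / 2) * y) + 1 * (y * Real.exp (-(κ / 2) * y))) := by
            refine mul_le_mul_of_nonneg_left (add_le_add g4 g5) this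
        _ = _ := by ring
    have htail := norm_tsum_sub_sum_le (half_pos hκ) (mul_nonneg zero_le_two (hK₀n c₂ hc₂)) hh0 hh1
      hterm N₁ N₂
    rw [← hSsum (fun n => f t (node n))] at htail
    have hpq : (∑ j ∈ S, (h * W (e j)) * exp (I * exp (node (e j)) * t)) +
        ∑ a ∈ Z, ∑ l ∈ Finset.range m,
          (J a l - h * ∑ j ∈ S, W (e j) * (P a l).eval (exp (node (e j)))) *
            ((t : ℂ) ^ l * exp (I * a * t)) =
        (∑ a ∈ Z, ∑ l ∈ Finset.range m, ((t : ℂ) ^ l * exp (I * a * t)) * J a l) +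
          h * ∑ j ∈ S, f t (node (e j)) := by
      have h1 : ∀ j ∈ S, f t (node (e j)) = W (e j) * exp (I * exp (node (e j)) * t) -
          ∑ a ∈ Z, ∑ l ∈ Finset.range m, ((t : ℂ) ^ l * exp (I * a * t)) *
            (W (e j) * (P a l).eval (exp (node (e j)))) := by
        intro j _
        rw [hfray t _ (hnodeQ _), mul_sub]
        congr 1
        simp only [hH, Finset.mul_sum, hW]
        refine Finset.sum_congr rfl fun a _ => Finset.sum_congr rfl fun l _ => by ring
      rw [Finset.sum_congr rfl h1, Finset.sum_sub_distrib, Finset.sum_comm (s := S) (t := Z), mul_sub, Finset.mul_sum]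
      have h2 : ∀ a ∈ Z, ∑ j ∈ S, ∑ l ∈ Finset.range m, ((t : ℂ) ^ l * exp (I * a * t)) *
            (W (e j) * (P a l).eval (exp (node (e j)))) =
          ∑ l ∈ Finset.range m, ((t : ℂ) ^ l * exp (I * a * t)) *
            ∑ j ∈ S, (W (e j) * (P a l).eval (exp (node (e j)))) := by
        intro a _
        rw [Finset.sum_comm]
        exact Finset.sum_congr rfl fun l _ => by rw [Finset.mul_sum]
      rw [Finset.sum_congr rfl h2]
      have h3 : ∀ a ∈ Z, ∑ l ∈ Finset.range m,
          (J a l - h * ∑ j ∈ S, W (e j) * (P a l).eval (exp (node (e j)))) *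
            ((t : ℂ) ^ l * exp (I * a * t)) =
          ∑ l ∈ Finset.range m, ((t : ℂ) ^ l * exp (I * a * t)) * J a l -
          h * ∑ l ∈ Finset.range m, ((t : ℂ) ^ l * exp (I * a * t)) *
            ∑ j ∈ S, (W (e j) * (P a l).eval (exp (node (e j)))) := by
        intro a _
        rw [Finset.mul_sum, ← Finset.sum_sub_distrib]
        exact Finset.sum_congr rfl fun l _ => by ring
      rw [Finset.sum_congr rfl h3, Finset.sum_sub_distrib, ← Finset.mul_sum]
      simp only [mul_assoc]
      ring
    have hmain := hsplit t ht
    simp only [hF, hQ] at hmain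
    rw [hmain, hpq, add_sub_add_left_eq_sub, hshift]
    set q := Real.exp (-2 * Real.pi * d / h)
    set X := ∫ x : ℝ, f t (x + (θ + d : ℝ) * I)
    set Y := ∑' n : ℤ, f t (node n)
    set V := ∑ j ∈ S, f t (node (e j))
    have hdec : X - h * V = -(h * Y - X) + h * (Y - V) := by ring
    rw [hdec]
    refine (norm_add_le _ _).trans ?_
    rw [norm_neg, norm_mul, norm_real, Real.norm_of_nonneg hh0.le]
    refine (add_le_add htrap htail).trans ?_
    rw [show κ / 2 / 2 = κ / 4 by ring, ← hK₂]
    set x₁ := Real.exp (-(N₁ * h))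
    set x₂ := Real.exp (-(κ / 4) * Real.exp (N₂ * h))
    have p1 : 0 ≤ q / (1 + t) := by positivity
    have p2 : 0 ≤ x₁ := (Real.exp_pos _).le
    have p3 : 0 ≤ x₂ := (Real.exp_pos _).le
    have : 4 * (B₀ / (1 + t)) * q = 4 * B₀ * (q / (1 + t)) := by ring
    rw [this]
    have hsum : (4 * B₀ + K₂) * (q / (1 + t) + x₁ + x₂) = 4 * B₀ * (q / (1 + t)) +
        K₂ * (x₁ + x₂) + (4 * (B₀ * x₁) + 4 * (B₀ * x₂) + K₂ * (q / (1 + t))) := by ring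
    rw [hsum]
    linarith [mul_nonneg hK₂n p1, mul_nonneg hB₀n p2, mul_nonneg hB₀n p3]

/-! ### Application to the kernel functions -/

theorem IsAdmissible.continuousOn_halfLine {Γ : ℂ → ℂ} {b : FreqSign} {rmax : ℝ}
    (hΓ : IsAdmissible Γ b rmax) : ContinuousOn (fun x : ℝ => Γ x) b.halfLine := fun x hx =>
  (hΓ.boundary x hx).comp continuous_ofReal.continuousWithinAt fun y _ => by simp

/-- The size of `Γ` is assumed only in the open sector. The bound reaches the half-line through `A =
Q Γ`, since `Q` is bounded below there. -/
theorem IsAdmissible.exists_norm_le {Γ : ℂ → ℂ} {rmax : ℝ} (h0 : 0 < rmax)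
    (h1 : rmax < Real.pi / 4) (hΓ : IsAdmissible Γ .pos rmax) :
    ∃ C κ, 0 < κ ∧ ∀ x : ℝ, 0 < x → ‖Γ x‖ ≤ C * Real.exp (-κ * x) := by
  obtain ⟨Z, m, A, -, hZ, -, -, hA, hb⟩ := hΓ.exists_regularization h0 h1
  obtain ⟨C, κ, hC, hκ, hAb⟩ := hb rmax h0 (by linarith)
  obtain ⟨c, hc, hQ⟩ := exists_le_norm_prod_ray Z m (θ := 0) le_rfl Real.pi_pos
    (fun a ha => ⟨(hZ a ha).1, by linarith [(hZ a ha).2], (hZ a ha).1.ne'⟩)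
  refine ⟨C / c, κ, hκ, fun x hx => ?_⟩
  have h2 := hAb (Real.log x) (by simp) (by simp [h0.le])
  have h3 := hQ (Real.log x)
  simp only [ofReal_zero, zero_mul, add_zero, ← ofReal_exp, Real.exp_log hx, ofReal_re] at h2 h3
  rw [hA, norm_mul] at h2
  rw [div_mul_eq_mul_div, le_div_iff₀ hc]
  nlinarith [norm_nonneg (Γ x)]

theorem kernelIntegrand_norm_le (s : Species) : ∃ B, 0 < B ∧ ∀ (Γ : ℂ → ℂ) (β t x : ℝ),
    ‖kernelIntegrand Γ s β t x‖ ≤ B * ‖Γ x‖ := by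
  obtain ⟨B, hB, h⟩ := Species.exists_norm_occupation_le one_pos
  refine ⟨B, hB, fun Γ β t x => ?_⟩
  have h1 := (h s β x (by simp)).2
  have h2 : ‖exp (I * x * t)‖ = 1 := by
    rw [norm_exp]
    simp
  have h3 : ‖(2 * Real.pi : ℂ)‖ = 2 * Real.pi := by
    simp [abs_of_pos Real.pi_pos]
  rw [kernelIntegrand, norm_div, norm_mul, norm_mul, h2, h3, mul_one]
  refine (div_le_self (by positivity) ?_).trans ?_
  · linarith [Real.pi_gt_three]
  · rw [mul_comm]
    exact mul_le_mul_of_nonneg_right h1 (norm_nonneg _)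

open MeasureTheory in
theorem aestronglyMeasurable_kernelIntegrand {Γ : ℂ → ℂ} {U : Set ℝ} (hU : MeasurableSet U)
    (hΓ : ContinuousOn (fun x : ℝ => Γ x) U) (s : Species) (β t : ℝ) :
    AEStronglyMeasurable (fun x : ℝ => kernelIntegrand Γ s β t x) (volume.restrict U) := by
  obtain ⟨B, hB, h⟩ := Species.exists_norm_occupation_le one_pos
  have hocc : Continuous fun x : ℝ => s.occupation β x := by
    rw [continuous_iff_continuousAt]
    intro x
    exact (s.differentiableAt_occupation (h s β x (by simp)).1).continuousAt.comp
      continuous_ofReal.continuousAt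
  refine ContinuousOn.aestronglyMeasurable ?_ hU
  unfold kernelIntegrand
  exact ((hΓ.mul hocc.continuousOn).mul (by fun_prop)).div_const _

open MeasureTheory in
theorem IsAdmissible.integrableOn_kernelIntegrand {Γ : ℂ → ℂ} {rmax : ℝ} (h0 : 0 < rmax)
    (h1 : rmax < Real.pi / 4) (hΓ : IsAdmissible Γ .pos rmax) (s : Species) (β t : ℝ) :
    IntegrableOn (fun x : ℝ => kernelIntegrand Γ s β t x) (Set.Ioi 0) := by
  obtain ⟨C, κ, hκ, hb⟩ := hΓ.exists_norm_le h0 h1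
  obtain ⟨B, hB, hk⟩ := kernelIntegrand_norm_le s
  have hi : IntegrableOn (fun x : ℝ => B * (C * Real.exp (-κ * x))) (Set.Ioi 0) :=
    ((integrableOn_exp_mul_Ioi (by linarith) 0).const_mul _).const_mul _
  refine hi.mono' (aestronglyMeasurable_kernelIntegrand measurableSet_Ioi
    hΓ.continuousOn_halfLine s β t) ?_
  refine (ae_restrict_iff' measurableSet_Ioi).2 (Filter.Eventually.of_forall fun x hx => ?_)
  exact (hk Γ β t x).trans (mul_le_mul_of_nonneg_left (hb x hx) hB.le)

open MeasureTheory in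
theorem IsAdmissible.continuous_kernel {Γ : ℂ → ℂ} {rmax : ℝ} (h0 : 0 < rmax)
    (h1 : rmax < Real.pi / 4) (hΓ : IsAdmissible Γ .pos rmax) (s : Species) (β : ℝ) :
    Continuous (kernel Γ .pos s β) := by
  obtain ⟨C, κ, hκ, hb⟩ := hΓ.exists_norm_le h0 h1
  obtain ⟨B, hB, hk⟩ := kernelIntegrand_norm_le s
  have hi : IntegrableOn (fun x : ℝ => B * (C * Real.exp (-κ * x))) (Set.Ioi 0) :=
    ((integrableOn_exp_mul_Ioi (by linarith) 0).const_mul _).const_mul _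
  refine continuous_of_dominated (fun t => aestronglyMeasurable_kernelIntegrand measurableSet_Ioi
    hΓ.continuousOn_halfLine s β t) (fun t => ?_) hi ?_
  · refine (ae_restrict_iff' measurableSet_Ioi).2 (Filter.Eventually.of_forall fun x hx => ?_)
    exact (hk Γ β t x).trans (mul_le_mul_of_nonneg_left (hb x hx) hB.le)
  · refine Filter.Eventually.of_forall fun x => ?_
    unfold kernelIntegrand
    fun_prop

-- The occupation factor is absorbed into `A`: it is analytic on the closed sector in use and
-- bounded by a constant free of `β`, so the estimate for general `A` applies with `C * B` in place
-- of `C`.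
open MeasureTheory in
theorem IsAdmissible.exists_expSum_approx_kernel {Γ : ℂ → ℂ} {rmax : ℝ} (h0 : 0 < rmax)
    (h1 : rmax < Real.pi / 4) (hΓ : IsAdmissible Γ .pos rmax) {d : ℝ} (hd0 : 0 < d)
    (hd : d < rmax) :
    ∃ (K κ : ℝ) (M : ℕ), 0 ≤ K ∧ 0 < κ ∧ ∀ (s : Species) (β h : ℝ), 0 < h → h ≤ 1 →
      Real.exp (-2 * Real.pi * d / h) ≤ 1 / 2 → ∀ N₁ N₂ : ℕ,
        ∃ p q : ℝ → ℂ, IsExpSum (N₁ + N₂) p ∧ (∀ T, IsExpSumLimit T M q) ∧ ∀ t : ℝ, 0 ≤ t →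
          ‖kernel Γ .pos s β t - (p t + q t)‖ ≤
            K * (Real.exp (-2 * Real.pi * d / h) / (1 + t) + Real.exp (-(N₁ * h)) +
              Real.exp (-κ * Real.exp (N₂ * h))) := by
  classical
  have hπ := Real.pi_pos
  obtain ⟨Z, m, A, hZne, hZ, hAd, hAc, hA, hb⟩ := hΓ.exists_regularization h0 h1
  -- an angle such that no pole lies on the three rays in use
  obtain ⟨θ, hθ, hθZ⟩ : ∃ θ ∈ Set.Ioo 0 (2 * (rmax - d)), θ ∉ (Z.image fun a => a.arg) ∪
      (Z.image fun a => a.arg - d) ∪ (Z.image fun a => a.arg - 2 * d) :=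
    (Set.Ioo_infinite (by linarith)).exists_notMem_finset _
  have hZθ : ∀ a ∈ Z, 0 < a.arg ∧ a.arg < Real.pi ∧
      a.arg ≠ θ ∧ a.arg ≠ θ + d ∧ a.arg ≠ θ + 2 * d := by
    intro a ha
    simp only [Finset.mem_union, Finset.mem_image, not_or, not_exists, not_and] at hθZ
    refine ⟨(hZ a ha).1, by linarith [(hZ a ha).2], hθZ.1.1 a ha, fun h => ?_, fun h => ?_⟩
    · exact hθZ.1.2 a ha (by linarith)
    · exact hθZ.2 a ha (by linarith)
  have hθ2 : θ + 2 * d < 2 * rmax := by linarith [hθ.2]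
  have hθ0 := hθ.1
  obtain ⟨C, κ, hC, hκ, hAb⟩ := hb (θ + 2 * d) (by linarith) hθ2
  have hcos : 0 < Real.cos (θ + 2 * d) := Real.cos_pos_of_mem_Ioo ⟨by linarith, by linarith⟩
  obtain ⟨B, hB, hocc⟩ := Species.exists_norm_occupation_le (one_div_pos.2 hcos)
  have hsector : ∀ u : ℂ, 0 ≤ u.im → u.im ≤ θ + 2 * d →
      |(exp u).im| ≤ 1 / Real.cos (θ + 2 * d) * |(exp u).re| := by
    intro u hu1 hu2
    have hc : Real.cos (θ + 2 * d) ≤ Real.cos u.im :=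
      Real.cos_le_cos_of_nonneg_of_le_pi hu1 (by linarith) hu2
    rw [exp_im, exp_re, abs_mul, abs_mul, abs_of_pos (Real.exp_pos _), div_mul_eq_mul_div, one_mul,
      le_div_iff₀ hcos, mul_assoc]
    refine mul_le_mul_of_nonneg_left ?_ (Real.exp_pos _).le
    have h2 := Real.abs_sin_le_one u.im
    have h3 := le_abs_self (Real.cos u.im)
    nlinarith [abs_nonneg (Real.sin u.im)]
  obtain ⟨K, M, hK, hcore⟩ := exists_expSum_approx_integral Z hZne m hθ0 hd0
    (by linarith) hZθ hκ (mul_nonneg hC hB.le)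
  refine ⟨K / (2 * Real.pi), κ / 4, M, by positivity, by positivity,
    fun s β h hh0 hh1 hq N₁ N₂ => ?_⟩
  have hoccd : ∀ u : ℂ, 0 ≤ u.im → u.im ≤ θ + 2 * d →
      DifferentiableAt ℂ (fun u => s.occupation β (exp u)) u := fun u hu1 hu2 =>
    (s.differentiableAt_occupation (hocc s β _ (hsector u hu1 hu2)).1).comp u
      differentiable_exp.differentiableAt
  obtain ⟨p, q, hp, hq', hpq⟩ := hcore (fun w => A w * s.occupation β w)
    ((hAc.mono fun u hu => ⟨hu.1, hu.2.trans_lt hθ2⟩).mul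
      fun u hu => (hoccd u hu.1 hu.2).continuousAt.continuousWithinAt)
    ((hAd.mono fun u hu => ⟨hu.1, hu.2.trans hθ2⟩).mul
      fun u hu => (hoccd u hu.1.le hu.2.le).differentiableWithinAt)
    (fun u hu1 hu2 => by
      rw [norm_mul, mul_right_comm]
      exact mul_le_mul (hAb u hu1 hu2) (hocc s β _ (hsector u hu1 hu2)).2 (norm_nonneg _)
        (by positivity))
    h hh0 hh1 hq N₁ N₂
  refine ⟨_, _, hp.const_mul (1 / (2 * Real.pi)), fun T => (hq' T).const_mul (1 / (2 * Real.pi)),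
    fun t ht => ?_⟩
  have hk : kernel Γ .pos s β t = 1 / (2 * Real.pi) *
      ∫ x : ℝ in Set.Ioi 0, A x * s.occupation β x / (∏ a ∈ Z, ((x : ℂ) - a) ^ m) *
        exp (I * x * t) := by
    rw [kernel, ← integral_const_mul]
    refine setIntegral_congr_fun measurableSet_Ioi fun x _ => ?_
    have hQ : ∏ a ∈ Z, ((x : ℂ) - a) ^ m ≠ 0 := by
      refine Finset.prod_ne_zero_iff.2 fun a ha => pow_ne_zero _ fun h => ?_
      have h2 := im_pos_of_arg_pos (hZθ a ha).1 (hZθ a ha).2.1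
      rw [← sub_eq_zero.1 h, ofReal_im] at h2
      exact lt_irrefl _ h2
    simp only [kernelIntegrand, hA]
    field_simp
  rw [hk, ← mul_add, ← mul_sub, norm_mul]
  have hn : ‖(1 / (2 * Real.pi) : ℂ)‖ = 1 / (2 * Real.pi) := by
    simp [abs_of_pos Real.pi_pos]
  rw [hn, div_mul_eq_mul_div K, div_mul_eq_mul_div, one_mul]
  exact div_le_div_of_nonneg_right (hpq t ht) (by positivity)

/-! ### From pointwise to `L¹` errors, and the count of exponentials -/

open MeasureTheory in
theorem expApprox_of_pointwise {Δ p q : ℝ → ℂ} {N M : ℕ} {T ε K ρ x : ℝ} (hT : 0 < T)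
    (hΔ : Continuous Δ) (hp : IsExpSum N p) (hq : IsExpSumLimit T M q)
    (hb : ∀ t : ℝ, 0 ≤ t → ‖Δ t - (p t + q t)‖ ≤ K * (ρ / (1 + t) + x))
    (hε : K * (ρ * Real.log (1 + T) + x * T) < ε) : ExpApprox Δ T ε (N + M) := by
  -- Replacing the limit `q` by genuine exponentials uses up half of the slack in `hε`, spread
  -- evenly over `[0, T]`.
  set η := (ε - K * (ρ * Real.log (1 + T) + x * T)) / (2 * T) with hη
  have hη0 : 0 < η := div_pos (by linarith) (by positivity)
  obtain ⟨q', hq', hqb⟩ := hq η hη0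
  have hpq := hp.add hq'
  obtain ⟨g, ω, hω, hsum⟩ := id hpq
  have hδc : Continuous fun t => Δ t - (p t + q' t) := hΔ.sub hpq.continuous
  refine ⟨g, ω, fun t => Δ t - (p t + q' t), hω, fun t _ => ?_, hδc.intervalIntegrable _ _, ?_⟩
  · rw [← hsum t]; ring
  have hne : ∀ t ∈ Set.uIcc 0 T, 1 + t ≠ 0 := fun t ht => by
    rw [Set.uIcc_of_le hT.le] at ht
    linarith [ht.1]
  have hinv : IntervalIntegrable (fun t : ℝ => ρ / (1 + t)) volume 0 T :=
    (ContinuousOn.div continuousOn_const (by fun_prop) hne).intervalIntegrable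
  have hmaj : IntervalIntegrable (fun t : ℝ => K * (ρ / (1 + t) + x) + η) volume 0 T :=
    ((hinv.add intervalIntegrable_const).const_mul K).add intervalIntegrable_const
  have hlog : ∫ t in (0 : ℝ)..T, ρ / (1 + t) = ρ * Real.log (1 + T) := by
    simp_rw [div_eq_mul_inv]
    rw [intervalIntegral.integral_const_mul,
      intervalIntegral.integral_comp_add_left (fun y => y⁻¹), integral_inv_of_pos (by norm_num)
        (by linarith)]
    simp
  calc ∫ t in (0 : ℝ)..T, ‖Δ t - (p t + q' t)‖
      ≤ ∫ t in (0 : ℝ)..T, (K * (ρ / (1 + t) + x) + η) := by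
        refine intervalIntegral.integral_mono_on hT.le (hδc.norm.intervalIntegrable _ _) hmaj
          fun t ht => ?_
        have : Δ t - (p t + q' t) = (Δ t - (p t + q t)) + (q t - q' t) := by ring
        rw [this]
        exact (norm_add_le _ _).trans (add_le_add (hb t ht.1) (hqb t ht))
    _ = K * (ρ * Real.log (1 + T) + x * T) + η * T := by
        rw [intervalIntegral.integral_add ((hinv.add intervalIntegrable_const).const_mul K)
          intervalIntegrable_const, intervalIntegral.integral_const_mul,
          intervalIntegral.integral_add hinv intervalIntegrable_const, hlog]
        simp
        ring
    _ < ε := by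
        have : η * T = (ε - K * (ρ * Real.log (1 + T) + x * T)) / 2 := by
          rw [hη]; field_simp
        linarith

/-- Choice of the step and the cutoffs of the quadrature. -/
theorem exists_expApprox_of_quadrature {Δ : ℝ → ℂ} {K κ d T ε : ℝ} {M : ℕ} (hK : 0 ≤ K)
    (hκ : 0 < κ) (hd : 0 < d) (hΔ : Continuous Δ)
    (happ : ∀ h, 0 < h → h ≤ 1 → Real.exp (-2 * Real.pi * d / h) ≤ 1 / 2 → ∀ N₁ N₂ : ℕ,
        ∃ p q : ℝ → ℂ, IsExpSum (N₁ + N₂) p ∧ (∀ T, IsExpSumLimit T M q) ∧ ∀ t : ℝ, 0 ≤ t →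
          ‖Δ t - (p t + q t)‖ ≤
            K * (Real.exp (-2 * Real.pi * d / h) / (1 + t) + Real.exp (-(N₁ * h)) +
              Real.exp (-κ * Real.exp (N₂ * h))))
    (hT : 0 < T) (hε : 0 < ε) (hL : 0 < Real.log (T / ε))
    (hℓ₁ : 1 ≤ Real.log (Real.log (Real.exp 1 + T) / ε))
    (hℓ₂ : 2 * Real.pi * d ≤ Real.log (Real.log (Real.exp 1 + T) / ε)) :
    ∃ N, ExpApprox Δ T ε N ∧
      (N : ℝ) ≤ (Real.log (T / ε) + Real.log (3 * K + 2) +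
          max 0 (Real.log ((Real.log (T / ε) + Real.log (3 * K + 2)) / κ))) *
        ((Real.log (Real.log (Real.exp 1 + T) / ε) + Real.log (3 * K + 2)) / (2 * Real.pi * d)) +
          (M + 2) := by
  have hπ := Real.pi_pos
  set L := Real.log (T / ε) with hLdef
  set ℓ := Real.log (Real.log (Real.exp 1 + T) / ε) with hℓdef
  -- Three error sources of size `K e^{-c} ε` add up to `3K / (3K + 2) · ε < ε`; the `2` keeps `c >
  -- 0` also when `K = 0`.
  set c := Real.log (3 * K + 2) with hc
  have hc0 : 0 < c := Real.log_pos (by linarith)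
  have hec : Real.exp (-c) * (3 * K + 2) = 1 := by
    rw [hc, Real.exp_neg, Real.exp_log (by linarith), inv_mul_cancel₀ (by linarith)]
  have hlogT : 1 ≤ Real.log (Real.exp 1 + T) := by
    rw [Real.le_log_iff_exp_le (by positivity)]
    linarith
  -- Makes the quadrature error `e^{-2πd/h}` equal to `e^{-c} ε / log (e + T)`.
  set h := 2 * Real.pi * d / (ℓ + c) with hh
  have hℓc : 0 < ℓ + c := by linarith
  have hh0 : 0 < h := by positivity
  have hh1 : h ≤ 1 := by rw [hh, div_le_one hℓc]; linarith
  have hqe : -2 * Real.pi * d / h = -(ℓ + c) := by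
    rw [hh]; field_simp
  have hq : Real.exp (-2 * Real.pi * d / h) ≤ 1 / 2 := by
    rw [hqe, Real.exp_neg, one_div]
    refine inv_anti₀ two_pos ?_
    linarith [Real.add_one_le_exp (ℓ + c)]
  -- Both cutoffs bring the truncation error below `e^{-c} ε / T`. The logarithm defining `N₂` may
  -- be negative, in which case the ceiling is `0`; hence the `max 0` in the count.
  set N₁ := ⌈(L + c) / h⌉₊ with hN₁
  set N₂ := ⌈Real.log ((L + c) / κ) / h⌉₊ with hN₂
  obtain ⟨p, q, hp, hq', hb⟩ := happ h hh0 hh1 hq N₁ N₂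
  have hLc : 0 < L + c := by linarith
  have heLc : Real.exp (-(L + c)) = Real.exp (-c) * (ε / T) := by
    rw [neg_add, Real.exp_add, hLdef, Real.exp_neg (Real.log _), Real.exp_log (by positivity),
      inv_div, mul_comm]
  have hx₁ : Real.exp (-(N₁ * h)) ≤ Real.exp (-c) * (ε / T) := by
    rw [← heLc]
    refine Real.exp_le_exp.2 (neg_le_neg ?_)
    rw [← div_le_iff₀ hh0]
    exact Nat.le_ceil _
  have hx₂ : Real.exp (-κ * Real.exp (N₂ * h)) ≤ Real.exp (-c) * (ε / T) := by
    rw [← heLc]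
    refine Real.exp_le_exp.2 ?_
    have h1 : (L + c) / κ ≤ Real.exp (N₂ * h) := by
      rw [← Real.log_le_iff_le_exp (by positivity), ← div_le_iff₀ hh0]
      exact Nat.le_ceil _
    rw [div_le_iff₀ hκ] at h1
    linarith
  have hρ : Real.exp (-(ℓ + c)) = Real.exp (-c) * (ε / Real.log (Real.exp 1 + T)) := by
    rw [neg_add, Real.exp_add, hℓdef, Real.exp_neg (Real.log _), Real.exp_log (by positivity),
      inv_div, mul_comm]
  refine ⟨N₁ + N₂ + M, expApprox_of_pointwise (K := K)
    (ρ := Real.exp (-c) * (ε / Real.log (Real.exp 1 + T)))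
    (x := 2 * (Real.exp (-c) * (ε / T))) hT hΔ hp (hq' T) (fun t ht => ?_) ?_, ?_⟩
  · refine (hb t ht).trans (mul_le_mul_of_nonneg_left ?_ hK)
    rw [hqe, hρ]
    linarith
  · have h1 : Real.log (1 + T) ≤ Real.log (Real.exp 1 + T) :=
      Real.log_le_log (by linarith) (by linarith [Real.add_one_le_exp 1])
    have h2 : ε / Real.log (Real.exp 1 + T) * Real.log (1 + T) ≤ ε := by
      rw [div_mul_eq_mul_div, div_le_iff₀ (by linarith)]
      exact mul_le_mul_of_nonneg_left h1 hε.le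
    have h3 : ε / T * T = ε := by field_simp
    have he := Real.exp_pos (-c)
    calc K * (Real.exp (-c) * (ε / Real.log (Real.exp 1 + T)) * Real.log (1 + T) +
          2 * (Real.exp (-c) * (ε / T)) * T)
        = K * Real.exp (-c) * (ε / Real.log (Real.exp 1 + T) * Real.log (1 + T) +
            2 * (ε / T * T)) := by ring
      _ ≤ K * Real.exp (-c) * (ε + 2 * ε) := by
          rw [h3]
          exact mul_le_mul_of_nonneg_left (by linarith) (by positivity)
      _ = (1 - 2 * Real.exp (-c)) * ε := by
          linear_combination ε * hec
      _ < ε := by nlinarith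
  · push_cast
    have h1 : (N₁ : ℝ) ≤ (L + c) / h + 1 := (Nat.ceil_lt_add_one (by positivity)).le
    have h2 : (N₂ : ℝ) ≤ max 0 (Real.log ((L + c) / κ)) / h + 1 := by
      have : N₂ ≤ ⌈max 0 (Real.log ((L + c) / κ)) / h⌉₊ :=
        Nat.ceil_mono (div_le_div_of_nonneg_right (le_max_right _ _) hh0.le)
      have h3 := Nat.ceil_lt_add_one (div_nonneg (le_max_left 0 (Real.log ((L + c) / κ))) hh0.le)
      have h4 : (N₂ : ℝ) ≤ (⌈max 0 (Real.log ((L + c) / κ)) / h⌉₊ : ℝ) := by exact_mod_cast this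
      linarith
    have h3 : (ℓ + c) / (2 * Real.pi * d) = 1 / h := by rw [hh, one_div_div]
    rw [h3, mul_one_div, add_div]
    linarith

open Filter in
/-- Lower-order terms are absorbed by shrinking the width of the strip. -/
theorem exists_count_le {r d : ℝ} (hr : 0 < r) (hrd : r < d) (κ c : ℝ) (hκ : 0 < κ) (M : ℕ) :
    ∃ σ L₀ : ℝ, 0 < σ ∧ ∀ L ℓ lam : ℝ, L₀ ≤ L → 0 < L → 1 ≤ lam → 0 ≤ ℓ + c →
      ℓ + c ≤ (1 + σ) * lam →
      (L + c + max 0 (Real.log ((L + c) / κ))) * ((ℓ + c) / (2 * Real.pi * d)) + (M + 2) ≤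
        1 / (2 * Real.pi * r) * lam * L := by
  have hπ := Real.pi_pos
  -- The gain `d / r > 1` is shared out as `(1 + σ)^2 + σ`: one factor for the corrections to `L`,
  -- one for `ℓ + c` against `lam`, and the last `σ` for `M + 2`.
  set σ := min 1 ((d / r - 1) / 4) with hσ
  have hρ : 1 < d / r := (one_lt_div hr).2 hrd
  have hσ0 : 0 < σ := lt_min one_pos (by linarith)
  have hσρ : (1 + σ) ^ 2 + σ ≤ d / r := by
    have h1 : σ ≤ 1 := min_le_left _ _
    have h2 : σ ≤ (d / r - 1) / 4 := min_le_right _ _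
    nlinarith
  have hd : 0 < d := hr.trans hrd
  have hlog : ∀ᶠ L : ℝ in atTop, max 0 (Real.log ((L + c) / κ)) ≤ σ / 2 * L := by
    have h1 : Tendsto (fun L : ℝ => (L + c) / κ) atTop atTop :=
      (tendsto_atTop_add_const_right _ c tendsto_id).atTop_div_const hκ
    have h2 := h1.eventually (Real.isLittleO_log_id_atTop.bound
      (show (0 : ℝ) < σ * κ / 4 by positivity))
    filter_upwards [h2, eventually_ge_atTop 0, eventually_ge_atTop |c|] with L h3 h4 h5
    have h6 : 0 ≤ L + c := by linarith [neg_abs_le c]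
    refine max_le (by positivity) ((le_abs_self _).trans (h3.trans ?_))
    rw [id, Real.norm_of_nonneg (by positivity)]
    have : σ * κ / 4 * ((L + c) / κ) = σ / 4 * (L + c) := by field_simp
    rw [this]
    have : L + c ≤ 2 * L := by linarith [le_abs_self c]
    nlinarith
  obtain ⟨L₀, hL₀⟩ := eventually_atTop.1 hlog
  refine ⟨σ, max L₀ (max (2 * c / σ) ((M + 2) * (2 * Real.pi * d) / σ)), hσ0,
    fun L ℓ lam hL hLpos hlam hℓ0 hℓ => ?_⟩
  have h1 := hL₀ L ((le_max_left _ _).trans hL)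
  have h2 : 2 * c / σ ≤ L := ((le_max_left _ _).trans (le_max_right _ _)).trans hL
  have h3 : (M + 2) * (2 * Real.pi * d) / σ ≤ L :=
    ((le_max_right _ _).trans (le_max_right _ _)).trans hL
  rw [div_le_iff₀ hσ0] at h2 h3
  have h4 : L + c + max 0 (Real.log ((L + c) / κ)) ≤ (1 + σ) * L := by nlinarith
  have h5 : (L + c + max 0 (Real.log ((L + c) / κ))) * (ℓ + c) ≤ (1 + σ) * L * ((1 + σ) * lam) :=
    mul_le_mul h4 hℓ hℓ0 (by positivity)
  have h6 : (M + 2) * (2 * Real.pi * d) ≤ σ * (lam * L) := by nlinarith [mul_pos hσ0 hLpos]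
  have h7 : ((1 + σ) ^ 2 + σ) * (lam * L) ≤ d / r * (lam * L) :=
    mul_le_mul_of_nonneg_right hσρ (by positivity)
  have h8 : 1 / (2 * Real.pi * r) * lam * L = d / r * (lam * L) / (2 * Real.pi * d) := by
    field_simp
  rw [h8, ← mul_div_assoc, le_div_iff₀ (by positivity), add_mul, div_mul_cancel₀ _ (by positivity)]
  nlinarith

theorem log_exp_one_add_le {T X : ℝ} (hT : 0 < T) (hX : 1 ≤ X) (h : Real.log T ≤ X) :
    Real.log (Real.exp 1 + T) ≤ 3 * X := by
  have he : Real.exp 1 + 1 ≤ Real.exp 2 := by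
    have h2 : Real.exp 2 = Real.exp 1 * Real.exp 1 := by rw [← Real.exp_add]; norm_num
    have := Real.add_one_le_exp 1
    nlinarith
  rcases le_total T 1 with h1 | h1
  · have : Real.log (Real.exp 1 + T) ≤ 2 := by
      rw [Real.log_le_iff_le_exp (by positivity)]
      linarith
    linarith
  · have h3 : Real.exp 1 + T ≤ Real.exp 2 * T := by nlinarith [Real.exp_pos 1]
    have := Real.log_le_log (by positivity) h3
    rw [Real.log_mul (Real.exp_ne_zero _) hT.ne', Real.log_exp] at this
    linarith

/-- The approximation statement for positive frequencies. -/
theorem IsAdmissible.exists_expApprox_pos {Γ : ℂ → ℂ} {rmax : ℝ} (h0 : 0 < rmax)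
    (h1 : rmax < Real.pi / 4) (hΓ : IsAdmissible Γ .pos rmax) (s : Species)
    {r : ℝ} (hr : 0 < r) (hr' : r < rmax) {T₀ : ℝ} (hT₀ : 0 < T₀) :
    ∃ ε₀ c : ℝ, 0 < ε₀ ∧ 0 < c ∧ ∀ β ε T : ℝ, 0 < ε → ε < ε₀ → T₀ ≤ T →
      (∃ N : ℕ, ExpApprox (kernel Γ .pos s β) T ε N ∧
        (N : ℝ) ≤ 1 / (2 * Real.pi * r) *
          Real.log (Real.log (Real.exp 1 + T) / ε) * Real.log (T / ε)) ∧
      (Real.log T ≤ (1 / ε) ^ c →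
        ∃ N : ℕ, ExpApprox (kernel Γ .pos s β) T ε N ∧
          (N : ℝ) ≤ 1 / (2 * Real.pi * r) * Real.log (1 / ε) * Real.log (T / ε)) := by
  have hπ := Real.pi_pos
  set d := (r + rmax) / 2 with hd
  have hd0 : 0 < d := by positivity
  obtain ⟨K, κ, M, hK, hκ, happ⟩ :=
    hΓ.exists_expSum_approx_kernel h0 h1 hd0 (show d < rmax by linarith)
  set C := Real.log (3 * K + 2) with hC
  have hC0 : 0 < C := Real.log_pos (by linarith)
  obtain ⟨σ, L₀, hσ, hcount⟩ := exists_count_le hr (show r < d by linarith) κ C hκ M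
  -- Lower bound imposed on `log (1 / ε)`: the first two entries make the step admissible, the third
  -- makes `log 3 + C` at most `σ / 2 * log (1 / ε)`.
  set Y := max (max 1 (2 * Real.pi * d)) (2 * (Real.log 3 + C) / σ) with hY
  -- The first entry forces `log (T / ε) ≥ max L₀ 1` for every `T ≥ T₀`, the second `log (1 / ε) ≥
  -- Y`. With `c = σ / 2`, a `T` within the growth limit adds at most `σ / 2 * log (1 / ε) + log 3`
  -- to `ℓ`.
  refine ⟨min (T₀ * Real.exp (-max L₀ 1)) (Real.exp (-Y)), σ / 2, by positivity, by positivity,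
    fun β ε T hε hε₀ hT => ?_⟩
  have hTpos : 0 < T := hT₀.trans_le hT
  have hL : max L₀ 1 ≤ Real.log (T / ε) := by
    rw [Real.le_log_iff_exp_le (by positivity), le_div_iff₀ hε]
    have h2 := hε₀.le.trans (min_le_left _ _)
    calc Real.exp (max L₀ 1) * ε ≤ Real.exp (max L₀ 1) * (T₀ * Real.exp (-max L₀ 1)) := by gcongr
      _ = T₀ := by rw [mul_left_comm, ← Real.exp_add, add_neg_cancel, Real.exp_zero, mul_one]
      _ ≤ T := hT
  have hlam : Y ≤ Real.log (1 / ε) := by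
    rw [Real.le_log_iff_exp_le (by positivity), le_div_iff₀ hε]
    have h2 := hε₀.le.trans (min_le_right _ _)
    calc Real.exp Y * ε ≤ Real.exp Y * Real.exp (-Y) := by gcongr
      _ = 1 := by rw [← Real.exp_add, add_neg_cancel, Real.exp_zero]
  have hlogT : 1 ≤ Real.log (Real.exp 1 + T) := by
    rw [Real.le_log_iff_exp_le (by positivity)]
    linarith
  set ℓ := Real.log (Real.log (Real.exp 1 + T) / ε) with hℓdef
  set lam := Real.log (1 / ε) with hlamdef
  set L := Real.log (T / ε) with hLdef
  have hℓ : lam ≤ ℓ := Real.log_le_log (by positivity) (by gcongr)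
  have hY1 : 1 ≤ Y := (le_max_left _ _).trans (le_max_left _ _)
  have hY2 : 2 * Real.pi * d ≤ Y := (le_max_right _ _).trans (le_max_left _ _)
  have hY3 : 2 * (Real.log 3 + C) / σ ≤ Y := le_max_right _ _
  rw [div_le_iff₀ hσ] at hY3
  have hlog3 : 0 < Real.log 3 := Real.log_pos (by norm_num)
  have hL0 : L₀ ≤ L := (le_max_left _ _).trans hL
  have hLpos : 0 < L := one_pos.trans_le ((le_max_right _ _).trans hL)
  obtain ⟨N, hN, hNle⟩ := exists_expApprox_of_quadrature hK hκ hd0 (hΓ.continuous_kernel h0 h1 s β)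
    (happ s β) hTpos hε hLpos (by linarith) (by linarith)
  have hℓC : 0 ≤ ℓ + C := by linarith
  refine ⟨⟨N, hN, hNle.trans (hcount L ℓ ℓ hL0 hLpos (by linarith) hℓC ?_)⟩, fun hTε =>
    ⟨N, hN, hNle.trans (hcount L ℓ lam hL0 hLpos (by linarith) hℓC ?_)⟩⟩
  · nlinarith
  · have hone : 1 ≤ 1 / ε := by
      have : 0 ≤ lam := by linarith
      by_contra hlt
      have := Real.log_neg (by positivity) (not_le.1 hlt)
      linarith
    have h2 := log_exp_one_add_le hTpos (Real.one_le_rpow hone (by positivity)) hTε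
    have h3 : ℓ ≤ Real.log 3 + σ / 2 * lam + lam := by
      have h4 : Real.log (Real.exp 1 + T) / ε ≤ 3 * (1 / ε) ^ (σ / 2) * (1 / ε) := by
        rw [mul_one_div]
        gcongr
      refine (Real.log_le_log (by positivity) h4).trans_eq ?_
      rw [Real.log_mul (by positivity) (by positivity), Real.log_mul (by norm_num) (by positivity),
        Real.log_rpow (by positivity)]
    nlinarith

/-! ### Negative frequencies by reflection -/

/-- Reflection of a function on the upper half-plane in the imaginary axis. -/
noncomputable def reflectIm (f : ℂ → ℂ) (z : ℂ) : ℂ :=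
  (starRingEnd ℂ) (f (-(starRingEnd ℂ) z))

open Filter Topology ComplexConjugate in
theorem tendsto_neg_conj_nhdsNE (z : ℂ) :
    Tendsto (fun w : ℂ => -conj w) (𝓝[≠] z) (𝓝[≠] (-conj z)) := by
  refine tendsto_nhdsWithin_iff.2 ⟨?_, ?_⟩
  · have : Continuous fun w : ℂ => -conj w := continuous_conj.neg
    exact (this.tendsto z).mono_left nhdsWithin_le_nhds
  · filter_upwards [self_mem_nhdsWithin] with w hw h
    exact hw ((starRingEnd ℂ).injective (neg_injective h))

open Filter Topology ComplexConjugate in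
theorem AnalyticAt.reflectIm {f : ℂ → ℂ} {z : ℂ} (hf : AnalyticAt ℂ f (-conj z)) :
    AnalyticAt ℂ (reflectIm f) z := by
  rw [analyticAt_iff_eventually_differentiableAt] at hf ⊢
  have hc : Continuous fun w : ℂ => -conj w := continuous_conj.neg
  filter_upwards [(hc.tendsto z).eventually hf] with w hw
  have h1 : DifferentiableAt ℂ (fun v => f (-v)) (conj w) :=
    DifferentiableAt.comp (conj w) (g := f) hw differentiable_neg.differentiableAt
  have h2 := h1.conj_conj
  rw [conj_conj] at h2
  exact h2

open ComplexConjugate in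
theorem MeromorphicAt.reflectIm {f : ℂ → ℂ} {z : ℂ} (hf : MeromorphicAt f (-conj z)) :
    MeromorphicAt (reflectIm f) z := by
  obtain ⟨n, hn⟩ := hf
  refine ⟨n, ?_⟩
  -- The sign compensates the reflection of `(w - z)^n`, which turns into `(-(w - z))^n`.
  have h1 := (analyticAt_const (v := (-1 : ℂ) ^ n)).mul hn.reflectIm
  refine h1.congr (Filter.Eventually.of_forall fun w => ?_)
  simp only [_root_.reflectIm, Pi.mul_apply, smul_eq_mul, map_mul, map_pow, map_sub, map_neg, conj_conj]
  rw [← mul_assoc, ← mul_pow]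
  congr 2
  ring

open ComplexConjugate in
theorem Complex.arg_neg_conj_of_pos {z : ℂ} (h : 0 < z.arg) (h' : z.arg < Real.pi) :
    (-conj z).arg = Real.pi - z.arg := by
  have him := im_pos_of_arg_pos h h'
  rw [arg_neg_eq_arg_add_pi_of_im_neg (by simpa using him), arg_conj, if_neg h'.ne]
  ring

-- The map `z ↦ -conj z` preserves the upper half-plane, the norm and `|Re z|`, and exchanges the
-- two sectors; the outer conjugation restores holomorphy.
open Filter Topology ComplexConjugate in
theorem IsAdmissible.reflectIm {Γ : ℂ → ℂ} {rmax : ℝ} (h1 : rmax < Real.pi / 4)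
    (hΓ : IsAdmissible Γ .neg rmax) : IsAdmissible (reflectIm Γ) .pos rmax := by
  have hπ := Real.pi_pos
  have hsec : ∀ z ∈ FreqSign.pos.sector (2 * rmax), -conj z ∈ FreqSign.neg.sector (2 * rmax) := by
    intro z hz
    have hz' : 0 < z.arg ∧ z.arg < 2 * rmax := hz
    have := arg_neg_conj_of_pos hz'.1 (by linarith)
    show Real.pi - 2 * rmax < (-conj z).arg ∧ (-conj z).arg < Real.pi
    rw [this]
    constructor <;> linarith
  have hnorm : ∀ z, ‖_root_.reflectIm Γ z‖ = ‖Γ (-conj z)‖ := fun z => norm_conj _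
  constructor
  · intro z hz
    exact (hΓ.meromorphic (-conj z) (by simpa using hz)).reflectIm
  · obtain ⟨G, ν, Λ, hν, h⟩ := hΓ.decay
    refine ⟨G, ν, Λ, hν, fun z hz hΛ => ?_⟩
    have := h _ (hsec z hz) (by rwa [norm_neg, norm_conj])
    rw [hnorm]
    simpa using this
  · have hinj : Set.InjOn (fun z : ℂ => -conj z)
        ((fun z : ℂ => -conj z) ⁻¹' {ω | ω ∈ FreqSign.neg.sector (2 * rmax) ∧
          meromorphicOrderAt Γ ω < 0}) :=
      fun z _ w _ h => (starRingEnd ℂ).injective (neg_injective h)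
    refine (hΓ.finite_poles.preimage hinj).subset fun z hz => ?_
    obtain ⟨hz1, hz2⟩ := hz
    refine ⟨hsec z hz1, ?_⟩
    have hz' : 0 < z.arg ∧ z.arg < 2 * rmax := hz1
    have him : 0 < (-conj z).im := by
      simpa using im_pos_of_arg_pos hz'.1 (by linarith)
    have hm := hΓ.meromorphic _ him
    -- A pole is recognised by the norm tending to infinity, a property that passes through the
    -- reflection without computing orders.
    rw [← tendsto_cobounded_iff_meromorphicOrderAt_neg hm, ← tendsto_norm_atTop_iff_cobounded]
    have hm' : MeromorphicAt (_root_.reflectIm Γ) z := hm.reflectIm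
    rw [← tendsto_cobounded_iff_meromorphicOrderAt_neg hm', ← tendsto_norm_atTop_iff_cobounded]
      at hz2
    have h2 := tendsto_neg_conj_nhdsNE (-conj z)
    rw [map_neg, conj_conj, neg_neg] at h2
    refine (hz2.comp h2).congr fun w => ?_
    simp [hnorm]
  · intro x hx
    have hx' : 0 < x := hx
    have h2 := hΓ.boundary (-x) (show -x < 0 by linarith)
    have h3 : (((-x : ℝ)) : ℂ) = -conj (x : ℂ) := by simp
    rw [h3] at h2
    have hc : Continuous fun w : ℂ => -conj w := continuous_conj.neg
    have h4 : ContinuousWithinAt (fun w : ℂ => Γ (-conj w)) {ω | 0 ≤ ω.im} (x : ℂ) :=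
      ContinuousWithinAt.comp (f := fun w : ℂ => -conj w) h2 hc.continuousWithinAt fun w hw => by
        have hw' : 0 ≤ w.im := hw
        show 0 ≤ (-conj w).im
        simpa using hw'
    exact continuous_conj.continuousAt.comp_continuousWithinAt h4
  · obtain ⟨C, δ, hδ, h⟩ := hΓ.bounded_zero
    refine ⟨C, δ, hδ, fun z hz hzδ => ?_⟩
    rw [hnorm]
    exact h _ (hsec z hz) (by rwa [norm_neg, norm_conj])

-- Reflection reverses the sign of `β`, so the positive-frequency result is needed for all real `β`
-- with constants independent of it.
open ComplexConjugate in
theorem kernelIntegrand_neg (Γ : ℂ → ℂ) (s : Species) (β t x : ℝ) :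
    kernelIntegrand Γ s β t ((-x : ℝ) : ℂ) =
      conj (kernelIntegrand (reflectIm Γ) s (-β) t (x : ℂ)) := by
  have hf : fermi β ((-x : ℝ) : ℂ) = conj (fermi (-β) (x : ℂ)) := by
    simp [fermi, ← exp_conj]
  have ho : s.occupation β ((-x : ℝ) : ℂ) = conj (s.occupation (-β) (x : ℂ)) := by
    cases s with
    | particle => simp only [Species.occupation, hf, map_sub, map_one]
    | hole => exact hf
  have h1 : Γ ((-x : ℝ) : ℂ) = conj (reflectIm Γ (x : ℂ)) := by simp [reflectIm]
  rw [kernelIntegrand, kernelIntegrand, ho, h1]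
  simp [← exp_conj, map_ofNat (starRingEnd ℂ) 2]

open ComplexConjugate MeasureTheory in
theorem kernel_neg_eq_conj (Γ : ℂ → ℂ) (s : Species) (β t : ℝ) :
    kernel Γ .neg s β t = conj (kernel (reflectIm Γ) .pos s (-β) t) := by
  have h1 : kernel Γ .neg s β t = ∫ x in Set.Iio (0 : ℝ), kernelIntegrand Γ s β t (x : ℂ) := rfl
  have h2 := integral_comp_neg_Ioi 0 fun x : ℝ => kernelIntegrand Γ s β t (x : ℂ)
  rw [neg_zero, integral_Iic_eq_integral_Iio] at h2
  rw [h1, ← h2, kernel, ← integral_conj]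
  simp_rw [kernelIntegrand_neg]
  rfl

open ComplexConjugate in
theorem ExpApprox.conj {Δ : ℝ → ℂ} {T ε : ℝ} {N : ℕ} (h : ExpApprox Δ T ε N) :
    ExpApprox (fun t => conj (Δ t)) T ε N := by
  obtain ⟨g, ω, δ, hω, hsum, hInt, hlt⟩ := h
  refine ⟨fun k => conj (g k), fun k => -conj (ω k), fun t => conj (δ t), fun k => ?_,
    fun t ht => ?_, ?_, ?_⟩
  · simpa using hω k
  · simp only [hsum t ht, map_add, map_sum, map_mul, ← exp_conj, conj_I, conj_ofReal]
    simp
  · rw [intervalIntegrable_iff] at hInt ⊢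
    exact conjCLE.toContinuousLinearMap.integrable_comp hInt
  · simpa using hlt

theorem theorem1 (rmax : ℝ) (hrmax : 0 < rmax) (hrmax' : rmax < Real.pi / 4)
    (Γ : ℂ → ℂ) (b : FreqSign) (hΓ : IsAdmissible Γ b rmax) (s : Species) :
    (∀ β t : ℝ, 0 ≤ t →
      MeasureTheory.IntegrableOn (fun ω : ℝ => kernelIntegrand Γ s β t (ω : ℂ)) b.halfLine) ∧
    ∀ r : ℝ, 0 < r → r < rmax → ∀ T₀ : ℝ, 0 < T₀ →
      ∃ ε₀ c : ℝ, 0 < ε₀ ∧ 0 < c ∧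
        ∀ β ε T : ℝ, 0 < ε → ε < ε₀ → T₀ ≤ T →
          (∃ N : ℕ, ExpApprox (kernel Γ b s β) T ε N ∧
            (N : ℝ) ≤ 1 / (2 * Real.pi * r) *
              Real.log (Real.log (Real.exp 1 + T) / ε) * Real.log (T / ε)) ∧
          (Real.log T ≤ (1 / ε) ^ c →
            ∃ N : ℕ, ExpApprox (kernel Γ b s β) T ε N ∧
              (N : ℝ) ≤ 1 / (2 * Real.pi * r) * Real.log (1 / ε) * Real.log (T / ε)) := by
  cases b with
  | pos =>
    exact ⟨fun β t _ => hΓ.integrableOn_kernelIntegrand hrmax hrmax' s β t,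
      fun r hr hr' T₀ hT₀ => hΓ.exists_expApprox_pos hrmax hrmax' s hr hr' hT₀⟩
  | neg =>
    have hΓ' := hΓ.reflectIm hrmax'
    refine ⟨fun β t _ => ?_, fun r hr hr' T₀ hT₀ => ?_⟩
    · have h1 := hΓ'.integrableOn_kernelIntegrand hrmax hrmax' s (-β) t
      have h2 := ((MeasureTheory.Measure.measurePreserving_neg
        (MeasureTheory.volume : MeasureTheory.Measure ℝ)).integrableOn_comp_preimage
        (Homeomorph.neg ℝ).measurableEmbedding (s := Set.Iio 0)
        (f := fun ω : ℝ => kernelIntegrand Γ s β t (ω : ℂ))).1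
      refine h2 ?_
      have h3 : (Neg.neg : ℝ → ℝ) ⁻¹' Set.Iio 0 = Set.Ioi 0 := by ext x; simp
      rw [h3]
      refine (conjCLE.toContinuousLinearMap.integrable_comp h1).congr
        (Filter.Eventually.of_forall fun x => ?_)
      exact (kernelIntegrand_neg Γ s β t x).symm
    · obtain ⟨ε₀, c, hε₀, hc, h⟩ := hΓ'.exists_expApprox_pos hrmax hrmax' s hr hr' hT₀
      refine ⟨ε₀, c, hε₀, hc, fun β ε T hε hεε₀ hT => ?_⟩
      have hk : kernel Γ .neg s β = fun t =>
          (starRingEnd ℂ) (kernel (reflectIm Γ) .pos s (-β) t) :=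
        funext (kernel_neg_eq_conj Γ s β)
      obtain ⟨⟨N, hN, hNle⟩, h2⟩ := h (-β) ε T hε hεε₀ hT
      rw [hk]
      refine ⟨⟨N, hN.conj, hNle⟩, fun hTε => ?_⟩
      obtain ⟨N, hN, hNle⟩ := h2 hTε
      exact ⟨N, hN.conj, hNle⟩
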